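/- A \emph{planar periodic framework} $(G,\Gamma,p,\pi)$ consists of a connected simple graph $G=(\mathsf V,\mathsf E)$, a subgroup $\Gamma\subset\mathrm{Aut}(G)$ that is free abelian of rank two, acts on $G$ without fixed vertices or fixed edges and has finitely many vertex orbits and edge orbits, an injective homomorphism $\pi$ from $\Gamma$ onto a rank-two lattice $\Lambda$ of translations of $\mathbb R^2$, and a placement $p:\mathsf V\to\mathbb R^2$ with $p(u)\neq p(v)$ for every edge $\{u,v\}$ and $p(\gamma v)=p(v)+\pi(\gamma)$ for all $\gamma\in\Gamma$, $v\in\mathsf V$. It is \emph{non-crossing} if any two distinct edges have disjoint closed segments, except possibly for a common endpoint. Its \emph{faces} are the connected components of the complement in $\mathbb R^2$ of the union of all points $p(v)$ and segments $[p(u),p(v)]$, $\{u,v\}\in\mathsf E$; it is assumed that the boundary of each face is a simple finite polygon (formed by the edges of a cycle of $G$). A \emph{periodic lifting} is a continuous function $H:\mathbb R^2\to\mathbb R$ that is affine on every face, $H(q)=\nu_U\cdot q+C_U$ for $q\in U$, and satisfies $H(q+\lambda)=H(q)$ for all $q\in\mathbb R^2$, $\lambda\in\Lambda$. It \emph{induces}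 $s:\mathsf E\to\mathbb R$ if for every oriented edge $(u,v)$, with $U$ the face on its right and $V$ the face on its left, $$\nu_V-\nu_U=s_{uv}\,(p(v)-p(u))^{\perp},\qquad (x,y)^\perp=(-y,x).$$ Choose two generators of $\Gamma$, with corresponding generators $\lambda_1,\lambda_2$ of $\Lambda$, and representatives of the $n$ vertex orbits, placed at $x_1,\dots,x_n$. Choose representatives $\beta$ of the $m$ edge orbits, each going from a vertex representative $i=i(\beta)$ to a translate of a vertex representative $j=j(\beta)$, with edge vector $e_\beta=(x_j+c_\beta^1\lambda_1+c_\beta^2\lambda_2)-x_i$, $c_\beta\in\mathbb Z^2$. The \emph{periodic rigidity matrix} $\mathbf R$ is the $m\times(2n+4)$ matrix whose row for $\beta$ is $$(0\ \dots\ 0\ \ {-e_\beta^t}\ \ 0\ \dots\ 0\ \ e_\beta^t\ \ 0\ \dots\ 0\ \ c_\beta^1e_\beta^t\ \ c_\beta^2e_\beta^t),$$ with $-e_\beta^t$ and $e_\beta^t$ in the columns of $i(\beta)$ and $j(\beta)$ (added if $i(\beta)=j(\beta)$). A \emph{periodic stress} is a function $s:\mathsf E\to\mathbb R$ that is constant on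 $\Gamma$-orbits of edges and whose values on the edge representatives form a vector in the kernel of $\mathbf R^t$. Given a lifting $H$, an edge is \emph{flat} if its two adjacent faces are lifted to the same plane; a non-flat edge is a \emph{mountain} (resp. \emph{valley}) edge if $H$ is concave (resp. convex) in a neighbourhood of each point of the open edge segment. \textbf{Theorem.} Let $(G,\Gamma,p,\pi)$ be a planar non-crossing periodic framework, all of whose faces are bounded by simple finite polygons. Every periodic lifting induces exactly one $s:\mathsf E\to\mathbb R$, and this $s$ is a periodic stress, for every choice of generators and representatives. Conversely, for every such choice, every periodic stress $s$ is induced by a periodic lifting $H$, determined up to an arbitrary additive constant: the periodic liftings inducing $s$ are exactly the functions $H+c$ with $c\in\mathbb R$. Moreover, if a periodic lifting $H$ induces $s$, then for every edge $e$: $s_e<0$ if and only if $e$ is a mountain edge, $s_e>0$ if and only if $e$ is a valley edge, and $s_e=0$ if and only if $e$ is flat. -/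

import Mathlib

open Set Filter Topology
open scoped Matrix

noncomputable section

/-- The Euclidean plane. -/
abbrev Plane : Type := EuclideanSpace ℝ (Fin 2)

/-- The rotation `(x, y)^⊥ = (-y, x)` of the plane by a quarter turn; it turns a direction vector
to its left. -/
def perp (v : Plane) : Plane := !₂[-(v 1), v 0]

/-- A planar periodic framework `(G, Γ, p, π)` on a connected simple graph `G`.
The group `Γ` of graph automorphisms is represented faithfully by a lattice of translations of rank
two, so it is free abelian of rank two; as the placement is equivariant, `Γ` fixes no vertex and no
edge, and since the numbers of orbits are finite, vertices have finite degree and the placement is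
locally finite. -/
structure PeriodicFramework {V : Type*} (G : SimpleGraph V) where
  /-- the underlying graph is connected -/
  connected : G.Connected
  /-- the periodicity group -/
  Γ : Subgroup (G ≃g G)
  /-- the placement of the vertices in the plane -/
  p : V → Plane
  /-- the representation of the periodicity group by translations -/
  π : Γ →* Multiplicative Plane
  /-- there are finitely many vertex orbits -/
  finite_vertex_orbits : ∃ S : Finset V, ∀ v : V, ∃ γ : Γ, ∃ w ∈ S, (γ : G ≃g G) w = v
  /-- there are finitely many edge orbits -/
  finite_edge_orbits : ∃ T : Finset G.edgeSet,
    ∀ e : G.edgeSet, ∃ γ : Γ, ∃ f ∈ T, (γ : G ≃g G).mapEdgeSet f = e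
  /-- the two endpoints of an edge are placed at distinct points -/
  placement_ne : ∀ u v : V, G.Adj u v → p u ≠ p v
  /-- the representation is faithful -/
  injective : Function.Injective π
  /-- the periods form a lattice of rank two in the plane -/
  lattice : ∃ b : Module.Basis (Fin 2) ℝ Plane,
    Set.range (fun γ : Γ => (π γ).toAdd) = (Submodule.span ℤ (Set.range b) : Set Plane)
  /-- the placement is periodic -/
  equivariant : ∀ (γ : Γ) (v : V), p ((γ : G ≃g G) v) = p v + (π γ).toAdd

namespace PeriodicFramework

variable {V : Type*} {G : SimpleGraph V}

/-- The translation vector of an element of the periodicity group. -/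
def period (F : PeriodicFramework G) (γ : F.Γ) : Plane := (F.π γ).toAdd

/-- The subset of the plane made of all placed vertices and all edge segments. -/
def carrier (F : PeriodicFramework G) : Set Plane :=
  Set.range F.p ∪ {q | ∃ u v : V, G.Adj u v ∧ q ∈ segment ℝ (F.p u) (F.p v)}

/-- `U` is a face: a connected component of the complement of the placed graph. -/
def IsFace (F : PeriodicFramework G) (U : Set Plane) : Prop :=
  ∃ q ∈ F.carrierᶜ, U = connectedComponentIn F.carrierᶜ q

/-- Two distinct edges induce closed segments that have at most a common endpoint of the two edges
in common. -/
def IsNonCrossing (F : PeriodicFramework G) : Prop :=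
  ∀ u v u' v' : V, G.Adj u v → G.Adj u' v' → s(u, v) ≠ s(u', v') →
    segment ℝ (F.p u) (F.p v) ∩ segment ℝ (F.p u') (F.p v') ⊆ F.p '' ({u, v} ∩ {u', v'})

/-- The boundary of each face is a simple finite polygon: it consists of the edge segments of a
(simple, finite) cycle of the graph. -/
def HasPolygonalFaces (F : PeriodicFramework G) : Prop :=
  ∀ U : Set Plane, F.IsFace U → ∃ (a : V) (w : G.Walk a a), w.IsCycle ∧
    frontier U = {q | ∃ u v : V, s(u, v) ∈ w.edges ∧ q ∈ segment ℝ (F.p u) (F.p v)}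

/-- `U` is the face to the left of the oriented edge `(u, v)`, that is, the face around which this
oriented edge runs counter-clockwise. -/
def IsLeftFace (F : PeriodicFramework G) (u v : V) (U : Set Plane) : Prop :=
  F.IsFace U ∧ ∀ q ∈ openSegment ℝ (F.p u) (F.p v),
    ∀ᶠ t : ℝ in 𝓝[>] 0, q + t • perp (F.p v - F.p u) ∈ U

/-- `(u, v, U, W)` is a tetrad: the oriented edge `(u, v)` runs clockwise around the face `U` and
counter-clockwise around the face `W`. -/
def IsTetrad (F : PeriodicFramework G) (u v : V) (U W : Set Plane) : Prop :=
  F.IsLeftFace v u U ∧ F.IsLeftFace u v W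

/-- On the set `U` the function `H` has the form `q ↦ ν · q + C`. -/
def HasAffineForm (H : Plane → ℝ) (U : Set Plane) (ν : Plane) (C : ℝ) : Prop :=
  ∀ q ∈ U, H q = inner ℝ ν q + C

/-- A lifting: a continuous height function that is affine on every face. -/
def IsLifting (F : PeriodicFramework G) (H : Plane → ℝ) : Prop :=
  Continuous H ∧ ∀ U, F.IsFace U → ∃ (ν : Plane) (C : ℝ), HasAffineForm H U ν C

/-- A periodic lifting: one that is invariant under all periods. -/
def IsPeriodicLifting (F : PeriodicFramework G) (H : Plane → ℝ) : Prop :=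
  F.IsLifting H ∧ ∀ (γ : F.Γ) (q : Plane), H (q + F.period γ) = H q

/-- `s` is the system of stress factors induced by `H`: for each edge and its tetrad `(u, v, U, W)`
one has `ν_W - ν_U = s_{uv} (p(v) - p(u))^⊥`. -/
def Induces (F : PeriodicFramework G) (H : Plane → ℝ) (s : G.edgeSet → ℝ) : Prop :=
  ∀ (u v : V) (h : G.Adj u v), ∃ (U W : Set Plane) (νU νW : Plane) (CU CW : ℝ),
    F.IsTetrad u v U W ∧ HasAffineForm H U νU CU ∧ HasAffineForm H W νW CW ∧
      νW - νU = s ⟨s(u, v), h⟩ • perp (F.p v - F.p u)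

/-- The two faces adjacent to the edge `uv` are lifted to the same plane. -/
def IsFlatEdge (F : PeriodicFramework G) (H : Plane → ℝ) (u v : V) : Prop :=
  ∃ (U W : Set Plane) (ν : Plane) (C : ℝ),
    F.IsTetrad u v U W ∧ HasAffineForm H U ν C ∧ HasAffineForm H W ν C

/-- The edge `uv` is a mountain edge: it is not flat, and the lifted terrain is concave near it. -/
def IsMountainEdge (F : PeriodicFramework G) (H : Plane → ℝ) (u v : V) : Prop :=
  ¬ F.IsFlatEdge H u v ∧ ∀ q ∈ openSegment ℝ (F.p u) (F.p v),
    ∃ ε > 0, ConcaveOn ℝ (Metric.ball q ε) H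

/-- The edge `uv` is a valley edge: it is not flat, and the lifted terrain is convex near it. -/
def IsValleyEdge (F : PeriodicFramework G) (H : Plane → ℝ) (u v : V) : Prop :=
  ¬ F.IsFlatEdge H u v ∧ ∀ q ∈ openSegment ℝ (F.p u) (F.p v),
    ∃ ε > 0, ConvexOn ℝ (Metric.ball q ε) H

/-- The choices used to write down the rigidity matrix: two generators of the periodicity group,
representatives of the `n` vertex orbits, and representatives of the `m` edge orbits, where the
representative `β` goes from the vertex representative `tail β` to the translate of the vertex
representative `head β` by the group element with integer coordinates `c β`. -/
structure Representatives (F : PeriodicFramework G) (n m : ℕ) where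
  /-- two generators of the periodicity group -/
  gen : Fin 2 → F.Γ
  gen_basis : ∀ γ : F.Γ, ∃! c : Fin 2 → ℤ, gen 0 ^ c 0 * gen 1 ^ c 1 = γ
  /-- the vertex representatives -/
  vtx : Fin n → V
  vtx_unique : ∀ v : V, ∃! i : Fin n, ∃ γ : F.Γ, (γ : G ≃g G) (vtx i) = v
  /-- the edge representatives -/
  edge : Fin m → G.edgeSet
  edge_unique : ∀ e : G.edgeSet, ∃! β : Fin m, ∃ γ : F.Γ, (γ : G ≃g G).mapEdgeSet (edge β) = e
  /-- the orbit in which the edge representative originates -/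
  tail : Fin m → Fin n
  /-- the orbit in which the edge representative ends -/
  head : Fin m → Fin n
  /-- the integer coordinates of the period occurring in the edge representative -/
  c : Fin m → Fin 2 → ℤ
  edge_eq : ∀ β, (edge β : Sym2 V) =
    s(vtx (tail β), ((gen 0 ^ c β 0 * gen 1 ^ c β 1 : F.Γ) : G ≃g G) (vtx (head β)))

namespace Representatives

variable {F : PeriodicFramework G} {n m : ℕ}

/-- The edge vector `e_β = (x_j + Λ c_β) - x_i`. -/
def edgeVector (R : F.Representatives n m) (β : Fin m) : Plane :=
  (F.p (R.vtx (R.head β)) + ∑ k, (R.c β k : ℝ) • F.period (R.gen k)) - F.p (R.vtx (R.tail β))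

/-- The periodic rigidity matrix, with `m` rows and `2n + 4` columns. The row of `β` has `-e_β` in
the columns of the vertex orbit `tail β`, `e_β` in the columns of the vertex orbit `head β` (these
add up to zero when the two orbits coincide), and `c_β^1 e_β`, `c_β^2 e_β` in the columns of the two
period generators. -/
def rigidityMatrix (R : F.Representatives n m) :
    Matrix (Fin m) ((Fin n × Fin 2) ⊕ (Fin 2 × Fin 2)) ℝ :=
  Matrix.of fun β => Sum.elim
    (fun ik => (if R.head β = ik.1 then R.edgeVector β ik.2 else 0)
      - (if R.tail β = ik.1 then R.edgeVector β ik.2 else 0))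
    (fun jk => (R.c β jk.1 : ℝ) * R.edgeVector β jk.2)

/-- `s` is a periodic stress: it is constant on the edge orbits, and its values on the edge
representatives form a vector in the kernel of the transposed rigidity matrix. -/
def IsPeriodicStress (R : F.Representatives n m) (s : G.edgeSet → ℝ) : Prop :=
  (∀ (γ : F.Γ) (e : G.edgeSet), s ((γ : G ≃g G).mapEdgeSet e) = s e) ∧
    R.rigidityMatrixᵀ *ᵥ (fun β => s (R.edge β)) = 0

end Representatives

end PeriodicFramework

end

/-! Liftings are treated as functions with prescribed kinks. Near a point of the open edge from `a`
to `b`, a lifting is an affine function plus `σ * max 0 (cr (b - a) (x - a))`, and this fold changes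
the gradient by `σ • perp (b - a)`, so `σ` is the stress factor. A lifting inducing `s` is therefore
a continuous function that is locally affine off the graph and has kink `s e` along every edge `e`
(`HasKinks`). The sign statement follows because the fold is convex. Two functions with equal kinks
differ by something locally affine off the countable set of vertices, hence by an affine function
(`HasKinks.exists_affine_sub`). An affine function invariant under two independent periods is
constant, which gives uniqueness up to a constant.

Existence comes from an explicit formula. Fix a base point `o` on no line spanned by an edge. Behind
each edge, seen from `o`, put the height `-cr (b - a) (q - a)`, and zero elsewhere; then add these
shadows with weights `s e`. Each shadow has kink one along its edge but jumps across the two rays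
behind its endpoints. Across the ray behind a vertex the jumps add up to a cross product with the
resultant of the stresses there. So equilibrium at all vertices makes the sum a function with kinks
`s` (`IsEquilibrium.hasKinks_shadow`). Conversely, subtract from a given function the shadows of the
edges at one vertex. The rest is affine on a small disc slit along the ray, and continuity across
the slit forces the resultant to vanish (`HasKinks.isEquilibrium`).

The columns of the two generators express periodicity. The shadow sum is zero near `o`; its gradient
near `o + λ₂` is determined by the edges crossing the segment from `o` to `o + λ₂`. The signed
number of translates of an edge representative that cross is a difference of floors of endpoint
coordinates along `λ₁`. It splits into contributions of the vertex orbits, which cancel by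
equilibrium, and `-c β 0`. The change of gradient is thus a nonzero multiple of the rotated force on
the first generator (`finsum_jumpTerm`). If a periodic function has kinks `s`, that force must
vanish, and interchanging the generators gives the other one. If both vanish, translation by a
generator changes the shadow sum by a constant only, and subtracting a linear function makes it
periodic. -/

/-! ### Plane geometry through the cross product -/

/-- The planar cross product. -/
noncomputable def cr (v x : Plane) : ℝ := v 0 * x 1 - v 1 * x 0

lemma inner_plane (v x : Plane) : inner ℝ v x = v 0 * x 0 + v 1 * x 1 := by
  simp [PiLp.inner_apply, Fin.sum_univ_two, mul_comm]

@[simp] lemma perp_zero_apply (v : Plane) : perp v 0 = -v 1 := by simp [perp]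

@[simp] lemma perp_one_apply (v : Plane) : perp v 1 = v 0 := by simp [perp]

lemma inner_perp (v x : Plane) : inner ℝ (perp v) x = cr v x := by
  rw [inner_plane, cr, perp_zero_apply, perp_one_apply]; ring

lemma plane_ext {x y : Plane} (h0 : x 0 = y 0) (h1 : x 1 = y 1) : x = y := by
  ext i; fin_cases i <;> assumption

lemma cr_add (v x y : Plane) : cr v (x + y) = cr v x + cr v y := by
  simp only [cr, PiLp.add_apply]; ring

lemma cr_sub (v x y : Plane) : cr v (x - y) = cr v x - cr v y := by
  simp only [cr, PiLp.sub_apply]; ring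

lemma cr_smul (v : Plane) (t : ℝ) (x : Plane) : cr v (t • x) = t * cr v x := by
  simp only [cr, PiLp.smul_apply, smul_eq_mul]; ring

lemma add_cr (v w x : Plane) : cr (v + w) x = cr v x + cr w x := by
  simp only [cr, PiLp.add_apply]; ring

lemma sub_cr (v w x : Plane) : cr (v - w) x = cr v x - cr w x := by
  simp only [cr, PiLp.sub_apply]; ring

lemma smul_cr (t : ℝ) (v x : Plane) : cr (t • v) x = t * cr v x := by
  simp only [cr, PiLp.smul_apply, smul_eq_mul]; ring

lemma cr_self (v : Plane) : cr v v = 0 := by simp only [cr]; ring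

lemma cr_swap (v w : Plane) : cr v w = -cr w v := by simp only [cr]; ring

@[simp] lemma cr_zero (v : Plane) : cr v 0 = 0 := by simp [cr]

@[simp] lemma zero_cr (v : Plane) : cr 0 v = 0 := by simp [cr]

lemma cr_sum {ι : Type*} (s : Finset ι) (f : ι → Plane) (x : Plane) :
    cr (∑ i ∈ s, f i) x = ∑ i ∈ s, cr (f i) x := by
  classical
  induction s using Finset.induction_on with
  | empty => simp
  | insert i s hi ih => rw [Finset.sum_insert hi, Finset.sum_insert hi, add_cr, ih]

lemma continuous_cr (v a : Plane) : Continuous fun x => cr v (x - a) := by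
  unfold cr; fun_prop

lemma cr_perp (v : Plane) : cr v (perp v) = v 0 ^ 2 + v 1 ^ 2 := by
  simp only [cr, perp_zero_apply, perp_one_apply]; ring

lemma cr_perp_pos {v : Plane} (hv : v ≠ 0) : 0 < cr v (perp v) := by
  rw [cr_perp]
  by_contra h
  apply hv
  have h0 : v 0 = 0 := by nlinarith [sq_nonneg (v 0), sq_nonneg (v 1)]
  have h1 : v 1 = 0 := by nlinarith [sq_nonneg (v 0), sq_nonneg (v 1)]
  exact plane_ext h0 h1

lemma perp_ne_zero {v : Plane} (hv : v ≠ 0) : perp v ≠ 0 := by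
  intro h
  have := cr_perp_pos hv
  simp [h] at this

/-- Two vectors which are linearly independent detect the zero vector. -/
lemma eq_zero_of_cr {v w x : Plane} (hvw : cr v w ≠ 0) (hv : cr v x = 0) (hw : cr w x = 0) :
    x = 0 := by
  have h0 : cr v w * x 0 = 0 := by
    have : cr v w * x 0 = w 0 * cr v x - v 0 * cr w x := by simp only [cr]; ring
    rw [this, hv, hw]; ring
  have h1 : cr v w * x 1 = 0 := by
    have : cr v w * x 1 = w 1 * cr v x - v 1 * cr w x := by simp only [cr]; ring
    rw [this, hv, hw]; ring
  exact plane_ext (by simpa [hvw] using h0) (by simpa [hvw] using h1)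

/-- A vector orthogonal to `v` is a multiple of `perp v`. -/
lemma exists_smul_perp {v ν : Plane} (hv : v ≠ 0) (h : inner ℝ ν v = 0) :
    ∃ σ : ℝ, ν = σ • perp v := by
  have hp := cr_perp_pos hv
  rw [cr_perp] at hp
  rw [inner_plane] at h
  refine ⟨(ν 1 * v 0 - ν 0 * v 1) / (v 0 ^ 2 + v 1 ^ 2), plane_ext ?_ ?_⟩
  · simp only [PiLp.smul_apply, perp_zero_apply, smul_eq_mul]
    field_simp
    linear_combination v 0 * h
  · simp only [PiLp.smul_apply, perp_one_apply, smul_eq_mul]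
    field_simp
    linear_combination v 1 * h

/-- A point on the line through two distinct points. -/
lemma exists_eq_lineMap_of_cr_eq_zero {v x : Plane} (hv : v ≠ 0) (h : cr v x = 0) :
    ∃ t : ℝ, x = t • v := by
  have hp := cr_perp_pos hv
  rw [cr_perp] at hp
  simp only [cr] at h
  refine ⟨(x 0 * v 0 + x 1 * v 1) / (v 0 ^ 2 + v 1 ^ 2), plane_ext ?_ ?_⟩
  · simp only [PiLp.smul_apply, smul_eq_mul]
    field_simp
    linear_combination -v 1 * h
  · simp only [PiLp.smul_apply, smul_eq_mul]
    field_simp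
    linear_combination v 0 * h

lemma cr_eq_zero_of_mem_segment {a b q : Plane} (h : q ∈ segment ℝ a b) :
    cr (b - a) (q - a) = 0 := by
  rw [segment_eq_image'] at h
  obtain ⟨t, -, rfl⟩ := h
  simp only [add_sub_cancel_left, cr_smul, cr_self, mul_zero]

/-! ### Functions that are affine near a point -/

/-- `f` is affine in a neighbourhood of `q`. -/
def AffAt (f : Plane → ℝ) (q : Plane) : Prop :=
  ∃ (ν : Plane) (C : ℝ), ∀ᶠ x in 𝓝 q, f x = inner ℝ ν x + C

lemma affAt_const (c : ℝ) (q : Plane) : AffAt (fun _ => c) q :=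
  ⟨0, c, by simp⟩

lemma affAt_cr (v a q : Plane) : AffAt (fun x => cr v (x - a)) q :=
  ⟨perp v, -cr v a, Eventually.of_forall fun x => by simp only [inner_perp, cr_sub]; ring⟩

lemma AffAt.congr {f g : Plane → ℝ} {q : Plane} (hf : AffAt f q) (h : ∀ᶠ x in 𝓝 q, g x = f x) :
    AffAt g q := by
  obtain ⟨ν, C, hf⟩ := hf
  exact ⟨ν, C, by filter_upwards [hf, h] with x h1 h2 using h2.trans h1⟩

lemma AffAt.add {f g : Plane → ℝ} {q : Plane} (hf : AffAt f q) (hg : AffAt g q) :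
    AffAt (fun x => f x + g x) q := by
  obtain ⟨ν, C, hf⟩ := hf
  obtain ⟨ν', C', hg⟩ := hg
  refine ⟨ν + ν', C + C', ?_⟩
  filter_upwards [hf, hg] with x h1 h2
  rw [h1, h2, inner_add_left]; ring

lemma AffAt.const_mul {f : Plane → ℝ} {q : Plane} (c : ℝ) (hf : AffAt f q) :
    AffAt (fun x => c * f x) q := by
  obtain ⟨ν, C, hf⟩ := hf
  refine ⟨c • ν, c * C, ?_⟩
  filter_upwards [hf] with x h1
  rw [h1, inner_smul_left]; simp; ring

lemma AffAt.neg {f : Plane → ℝ} {q : Plane} (hf : AffAt f q) : AffAt (fun x => -f x) q := by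
  simpa using hf.const_mul (-1)

lemma AffAt.sub {f g : Plane → ℝ} {q : Plane} (hf : AffAt f q) (hg : AffAt g q) :
    AffAt (fun x => f x - g x) q := by
  simpa [sub_eq_add_neg] using hf.add hg.neg

lemma AffAt.sum {ι : Type*} {s : Finset ι} {f : ι → Plane → ℝ} {q : Plane}
    (h : ∀ i ∈ s, AffAt (f i) q) : AffAt (fun x => ∑ i ∈ s, f i x) q := by
  classical
  induction s using Finset.induction_on with
  | empty => simpa using affAt_const 0 q
  | insert i s hi ih =>
    simp only [Finset.sum_insert hi]
    exact (h i (Finset.mem_insert_self i s)).add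
      (ih fun j hj => h j (Finset.mem_insert_of_mem hj))

lemma AffAt.comp_add {f : Plane → ℝ} {q w : Plane} (hf : AffAt f (q + w)) :
    AffAt (fun x => f (x + w)) q := by
  obtain ⟨ν, C, hf⟩ := hf
  refine ⟨ν, inner ℝ ν w + C, ?_⟩
  have : Tendsto (fun x : Plane => x + w) (𝓝 q) (𝓝 (q + w)) :=
    (continuous_id.add continuous_const).tendsto q
  filter_upwards [this.eventually hf] with x hx
  rw [hx, inner_add_right]; ring

lemma affAt_of_affine {f : Plane → ℝ} {ν : Plane} {C : ℝ} (h : ∀ x, f x = inner ℝ ν x + C)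
    (q : Plane) : AffAt f q := ⟨ν, C, Eventually.of_forall h⟩

/-- An affine function is determined by its germ at a point. -/
lemma affine_unique_of_eventually {ν ν' : Plane} {C C' : ℝ} {q : Plane}
    (h : ∀ᶠ x in 𝓝 q, inner ℝ ν x + C = inner ℝ ν' x + C') : ν = ν' ∧ C = C' := by
  have key : ν = ν' := by
    rw [← sub_eq_zero]
    have ht : Tendsto (fun t : ℝ => q + t • (ν - ν')) (𝓝[>] 0) (𝓝 q) := by
      have : Tendsto (fun t : ℝ => q + t • (ν - ν')) (𝓝 0) (𝓝 (q + (0:ℝ) • (ν - ν'))) :=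
        Continuous.tendsto (by fun_prop) 0
      simpa using this.mono_left nhdsWithin_le_nhds
    obtain ⟨t, h1, h2⟩ := ((ht.eventually h).and self_mem_nhdsWithin).exists
    have h0 := h.self_of_nhds
    have h3 : t * inner ℝ (ν - ν') (ν - ν') = 0 := by
      simp only [inner_add_right, inner_smul_right] at h1
      rw [inner_sub_left]
      linear_combination h1 - h0
    have h4 : t ≠ 0 := ne_of_gt h2
    exact inner_self_eq_zero.1 ((mul_eq_zero.1 h3).resolve_left h4)
  refine ⟨key, ?_⟩
  have h0 := h.self_of_nhds
  rw [key] at h0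
  linarith

/-- A function that is locally affine on a preconnected set is affine there. -/
lemma exists_affine_of_affAt {f : Plane → ℝ} {U : Set Plane} (hU : IsPreconnected U)
    (h : ∀ q ∈ U, AffAt f q) : ∃ (ν : Plane) (C : ℝ), ∀ q ∈ U, f q = inner ℝ ν q + C := by
  rcases U.eq_empty_or_nonempty with rfl | ⟨q₀, hq₀⟩
  · exact ⟨0, 0, by simp⟩
  choose! ν C hνC using h
  have : PreconnectedSpace U := Subtype.preconnectedSpace hU
  have hloc : IsLocallyConstant fun q : U => (ν q, C q) := by
    rw [IsLocallyConstant.iff_eventually_eq]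
    intro q
    have h1 := (hνC q q.2).eventually_nhds
    have h2 : ∀ᶠ y : U in 𝓝 q, ∀ᶠ x in 𝓝 (y : Plane), f x = inner ℝ (ν q) x + C q :=
      continuous_subtype_val.continuousAt.eventually h1
    filter_upwards [h2] with y hy
    have := affine_unique_of_eventually (q := (y : Plane)) (ν := ν y) (C := C y) (ν' := ν q)
      (C' := C q) (by filter_upwards [hy, hνC y y.2] with x h3 h4 using h4.symm.trans h3)
    exact Prod.ext this.1 this.2
  refine ⟨ν q₀, C q₀, fun q hq => ?_⟩
  have := hloc.apply_eq_of_preconnectedSpace ⟨q, hq⟩ ⟨q₀, hq₀⟩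
  simp only [Prod.mk.injEq] at this
  rw [(hνC q hq).self_of_nhds, this.1, this.2]

/-- A continuous function on the plane that is locally affine off a countable set is affine. -/
lemma exists_affine_of_countable {f : Plane → ℝ} {A : Set Plane} (hA : A.Countable)
    (hf : Continuous f) (h : ∀ q ∉ A, AffAt f q) :
    ∃ (ν : Plane) (C : ℝ), ∀ q, f q = inner ℝ ν q + C := by
  have hrank : 1 < Module.rank ℝ Plane := by
    rw [← Module.finrank_eq_rank]; simp
  have hc := (hA.isConnected_compl_of_one_lt_rank hrank).isPreconnected
  obtain ⟨ν, C, hν⟩ := exists_affine_of_affAt hc h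
  refine ⟨ν, C, fun q => ?_⟩
  have hd : Dense Aᶜ := hA.dense_compl ℝ
  have hcont : Continuous fun q : Plane => inner ℝ ν q + C := by fun_prop
  exact congrFun (Continuous.ext_on hd hf hcont hν) q

/-- Near `q`, the function `f` is an affine function plus `σ` times the fold along the line
through `a` with direction `v`. -/
def KinkAt (f : Plane → ℝ) (a v : Plane) (σ : ℝ) (q : Plane) : Prop :=
  AffAt (fun x => f x - σ * max 0 (cr v (x - a))) q

lemma KinkAt.affAt_sub {f g : Plane → ℝ} {a v : Plane} {σ : ℝ} {q : Plane}
    (hf : KinkAt f a v σ q) (hg : KinkAt g a v σ q) : AffAt (fun x => f x - g x) q :=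
  (AffAt.sub hf hg).congr (Eventually.of_forall fun x => by ring)

lemma KinkAt.add_affAt {f g : Plane → ℝ} {a v : Plane} {σ : ℝ} {q : Plane}
    (hf : KinkAt f a v σ q) (hg : AffAt g q) : KinkAt (fun x => f x + g x) a v σ q :=
  (AffAt.add hf hg).congr (Eventually.of_forall fun x => by ring)

lemma KinkAt.congr {f g : Plane → ℝ} {a v : Plane} {σ : ℝ} {q : Plane}
    (hf : KinkAt f a v σ q) (h : ∀ᶠ x in 𝓝 q, g x = f x) : KinkAt g a v σ q :=
  AffAt.congr hf (by filter_upwards [h] with x hx; rw [hx])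

/-- Reversing the direction of the line does not change the kink. -/
lemma KinkAt.reverse {f : Plane → ℝ} {a b : Plane} {σ : ℝ} {q : Plane}
    (hf : KinkAt f a (b - a) σ q) : KinkAt f b (a - b) σ q := by
  -- Since `max 0 (-t) = max 0 t - t`, the folds of the two orientations differ by an affine
  -- function.
  refine (AffAt.add hf ((affAt_cr (b - a) a q).const_mul σ)).congr
    (Eventually.of_forall fun x => ?_)
  have : cr (a - b) (x - b) = -cr (b - a) (x - a) := by
    simp only [cr, PiLp.sub_apply]; ring
  rw [this]
  rcases le_total 0 (cr (b - a) (x - a)) with h | h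
  · rw [max_eq_left (by linarith : -cr (b - a) (x - a) ≤ 0), max_eq_right h]; ring
  · rw [max_eq_right (by linarith : 0 ≤ -cr (b - a) (x - a)), max_eq_left h]; ring

/-! ### The shadow of a segment seen from a base point -/

/-- The indicator of the half-plane to the left of the line from `o` to `a`. -/
noncomputable def side (o a q : Plane) : ℝ := if 0 ≤ cr (a - o) (q - o) then 1 else 0

/-- The signed height behind the line through `a` and `b`, seen from `o`. -/
noncomputable def fold (o a b q : Plane) : ℝ :=
  -- The tested number equals `cr (b - a) (o - a)`, so it tells on which side of the line `o` lies.
  -- Beyond the line, as seen from `o`, both branches give `-cr (b - a) (q - a)`; on the side of `o`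
  -- both give zero.
  if 0 < cr (a - o) (b - o) then max 0 (-cr (b - a) (q - a)) else -max 0 (cr (b - a) (q - a))

lemma continuous_fold (o a b : Plane) : Continuous (fold o a b) := by
  have := continuous_cr (b - a) a
  unfold fold
  split_ifs
  · exact continuous_const.max this.neg
  · exact (continuous_const.max this).neg

lemma fold_self (o a b : Plane) : fold o a b a = 0 := by simp [fold]

lemma fold_right (o a b : Plane) : fold o a b b = 0 := by simp [fold, cr_self]

/-- The difference of the two `side` values also changes sign under the swap, so the shadow of a
segment does not depend on its orientation. -/
lemma fold_swap {o a b : Plane} (h : cr (a - o) (b - o) ≠ 0) (q : Plane) :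
    fold o b a q = -fold o a b q := by
  have h1 : cr (b - o) (a - o) = -cr (a - o) (b - o) := cr_swap _ _
  have h2 : cr (a - b) (q - b) = -cr (b - a) (q - a) := by
    simp only [cr, PiLp.sub_apply]; ring
  unfold fold
  rw [h1, h2]
  rcases lt_or_gt_of_ne h with h | h
  · rw [if_pos (by linarith), if_neg (by linarith), neg_neg, neg_neg]
  · rw [if_neg (by linarith), if_pos h]

lemma side_eventuallyEq {o a q₀ : Plane} (h : cr (a - o) (q₀ - o) ≠ 0) :
    ∀ᶠ q in 𝓝 q₀, side o a q = side o a q₀ := by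
  have hc := (continuous_cr (a - o) o).continuousAt (x := q₀)
  rcases lt_or_gt_of_ne h with h | h
  · filter_upwards [hc.eventually_lt_const h] with q hq
    simp [side, not_le.2 hq, not_le.2 h]
  · filter_upwards [hc.eventually_const_lt h] with q hq
    simp [side, hq.le, h.le]

/-- The factor `1 - τ` changes sign at `a`: on the line from `o` through `a`, exactly the points
behind `a` are separated from `o` by the line through `a` and `b`. -/
lemma cr_sub_add_smul (o a b : Plane) (τ : ℝ) :
    cr (b - a) (o + τ • (a - o) - a) = (1 - τ) * cr (a - o) (b - o) := by
  simp only [cr, PiLp.sub_apply, PiLp.add_apply, PiLp.smul_apply, smul_eq_mul]; ring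

lemma fold_eventually_eq_zero {o a b : Plane} {τ : ℝ} (hτ : τ < 1)
    (h : cr (a - o) (b - o) ≠ 0) : ∀ᶠ q in 𝓝 (o + τ • (a - o)), fold o a b q = 0 := by
  have hc := (continuous_cr (b - a) a).continuousAt (x := o + τ • (a - o))
  have hv := cr_sub_add_smul o a b τ
  rcases lt_or_gt_of_ne h with h | h
  · have : cr (b - a) (o + τ • (a - o) - a) < 0 := by rw [hv]; nlinarith
    filter_upwards [hc.eventually_lt_const this] with q hq
    simp [fold, not_lt.2 h.le, hq.le]
  · have : 0 < cr (b - a) (o + τ • (a - o) - a) := by rw [hv]; nlinarith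
    filter_upwards [hc.eventually_const_lt this] with q hq
    simp [fold, h, hq.le]

lemma fold_eventually_eq_cr {o a b : Plane} {τ : ℝ} (hτ : 1 < τ)
    (h : cr (a - o) (b - o) ≠ 0) :
    ∀ᶠ q in 𝓝 (o + τ • (a - o)), fold o a b q = -cr (b - a) (q - a) := by
  have hc := (continuous_cr (b - a) a).continuousAt (x := o + τ • (a - o))
  have hv := cr_sub_add_smul o a b τ
  rcases lt_or_gt_of_ne h with h | h
  · have : 0 < cr (b - a) (o + τ • (a - o) - a) := by rw [hv]; nlinarith
    filter_upwards [hc.eventually_const_lt this] with q hq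
    simp [fold, not_lt.2 h.le, hq.le]
  · have : cr (b - a) (o + τ • (a - o) - a) < 0 := by rw [hv]; nlinarith
    filter_upwards [hc.eventually_lt_const this] with q hq
    simp [fold, h, hq.le]

lemma affAt_fold {o a b q₀ : Plane} (h : cr (b - a) (q₀ - a) ≠ 0) : AffAt (fold o a b) q₀ := by
  have hc := (continuous_cr (b - a) a).continuousAt (x := q₀)
  have h0 := affAt_const 0 q₀
  have h1 := affAt_cr (b - a) a q₀
  rcases lt_or_gt_of_ne h with h | h <;> by_cases hD : 0 < cr (a - o) (b - o)
  · refine h1.neg.congr ?_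
    filter_upwards [hc.eventually_lt_const h] with q hq
    simp [fold, hD, hq.le]
  · refine h0.congr ?_
    filter_upwards [hc.eventually_lt_const h] with q hq
    simp [fold, hD, hq.le]
  · refine h0.congr ?_
    filter_upwards [hc.eventually_const_lt h] with q hq
    simp [fold, hD, hq.le]
  · refine h1.neg.congr ?_
    filter_upwards [hc.eventually_const_lt h] with q hq
    simp [fold, hD, hq.le]

lemma cr_left_of_lineMap (o a b : Plane) (t : ℝ) :
    cr (a - o) (a + t • (b - a) - o) = t * cr (a - o) (b - o) := by
  simp only [cr, PiLp.sub_apply, PiLp.add_apply, PiLp.smul_apply, smul_eq_mul]; ring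

lemma cr_right_of_lineMap (o a b : Plane) (t : ℝ) :
    cr (b - o) (a + t • (b - a) - o) = (t - 1) * cr (a - o) (b - o) := by
  simp only [cr, PiLp.sub_apply, PiLp.add_apply, PiLp.smul_apply, smul_eq_mul]; ring

/-- Off the segment, the shadow height with frozen coefficient is locally affine. -/
lemma affAt_frozen {o a b q₀ : Plane} (hD : cr (a - o) (b - o) ≠ 0) (hq : q₀ ∉ segment ℝ a b) :
    AffAt (fun q => (side o a q₀ - side o b q₀) * fold o a b q) q₀ := by
  by_cases h : cr (b - a) (q₀ - a) = 0
  · have hab : b - a ≠ 0 := by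
      intro h0
      rw [sub_eq_zero.1 h0, cr_self] at hD
      exact hD rfl
    obtain ⟨t, ht⟩ := exists_eq_lineMap_of_cr_eq_zero hab h
    obtain rfl : q₀ = a + t • (b - a) := by rw [← ht]; abel
    -- On the line but outside the segment the fold still has a kink, but its coefficient vanishes:
    -- the rays from `o` to the endpoints have the point on the same side.
    have : side o a (a + t • (b - a)) = side o b (a + t • (b - a)) := by
      unfold side
      rw [cr_left_of_lineMap, cr_right_of_lineMap]
      have ht' : t < 0 ∨ 1 < t := by
        by_contra! hc
        exact hq (by rw [segment_eq_image']; exact ⟨t, hc, rfl⟩)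
      rcases lt_or_gt_of_ne hD with hD | hD <;> rcases ht' with ht' | ht'
      · rw [if_pos (by nlinarith), if_pos (by nlinarith)]
      · rw [if_neg (by nlinarith), if_neg (by nlinarith)]
      · rw [if_neg (by nlinarith), if_neg (by nlinarith)]
      · rw [if_pos (by nlinarith), if_pos (by nlinarith)]
    simpa [this] using affAt_const 0 _
  · exact (affAt_fold h).const_mul _

/-- On the open segment, the shadow height with frozen coefficient has a kink of strength one. -/
lemma kinkAt_frozen {o a b q₀ : Plane} (hD : cr (a - o) (b - o) ≠ 0)
    (hq : q₀ ∈ openSegment ℝ a b) :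
    KinkAt (fun q => (side o a q₀ - side o b q₀) * fold o a b q) a (b - a) 1 q₀ := by
  rw [openSegment_eq_image'] at hq
  obtain ⟨t, ⟨ht0, ht1⟩, rfl⟩ := hq
  simp only
  unfold KinkAt side
  rw [cr_left_of_lineMap, cr_right_of_lineMap]
  rcases lt_or_gt_of_ne hD with hD | hD
  · rw [if_neg (by nlinarith), if_pos (by nlinarith)]
    refine (affAt_const 0 _).congr (Eventually.of_forall fun x => ?_)
    simp [fold, not_lt.2 hD.le]
  · rw [if_pos (by nlinarith), if_neg (by nlinarith)]
    refine (affAt_cr (b - a) a _).neg.congr (Eventually.of_forall fun x => ?_)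
    simp only [fold, if_pos hD]
    rcases le_total 0 (cr (b - a) (x - a)) with h | h
    · rw [max_eq_left (by linarith : -cr (b - a) (x - a) ≤ 0), max_eq_right h]; ring
    · rw [max_eq_right (by linarith : 0 ≤ -cr (b - a) (x - a)), max_eq_left h]; ring

/-- A segment casts its shadow behind itself. -/
lemma exists_mem_segment_of_shadow_ne_zero {o a b q : Plane} (hD : cr (a - o) (b - o) ≠ 0)
    (h : (side o a q - side o b q) * fold o a b q ≠ 0) :
    ∃ x ∈ segment ℝ a b, dist x o ≤ dist q o := by
  have hside : side o a q ≠ side o b q := fun h' => h (by rw [h', sub_self, zero_mul])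
  have hfold : fold o a b q ≠ 0 := right_ne_zero_of_mul h
  set D := cr (a - o) (b - o) with hDdef
  -- Coordinates of `q - o` in the basis `a - o`, `b - o`, by Cramer's rule. The shadow is the part
  -- of the cone `0 ≤ α, β` where `1 < α + β`.
  set α := cr (q - o) (b - o) / D with hα
  set β := cr (a - o) (q - o) / D with hβ
  have hα' : cr (b - o) (q - o) = -(α * D) := by
    rw [hα, div_mul_cancel₀ _ hD, cr_swap]
  have hβ' : cr (a - o) (q - o) = β * D := by rw [hβ, div_mul_cancel₀ _ hD]
  have hq : q - o = α • (a - o) + β • (b - o) := by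
    rw [← sub_eq_zero]
    refine eq_zero_of_cr hD ?_ ?_
    · rw [cr_sub, cr_add, cr_smul, cr_smul, cr_self, hβ']; ring
    · rw [cr_sub, cr_add, cr_smul, cr_smul, cr_self, hα', cr_swap (b - o) (a - o), ← hDdef]; ring
  have hk : cr (b - a) (q - a) = (1 - (α + β)) * D := by
    have e1 : cr (b - a) (q - a) = cr (b - o) (q - o) - cr (a - o) (q - o) + D := by
      rw [hDdef]; simp only [cr, PiLp.sub_apply]; ring
    rw [e1, hα', hβ']; ring
  have hfar : 1 < α + β := by
    by_contra! hc
    apply hfold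
    unfold fold
    rw [hk, ← hDdef]
    rcases lt_or_gt_of_ne hD with hD | hD
    · rw [if_neg (by linarith), max_eq_left (by nlinarith), neg_zero]
    · rw [if_pos hD, max_eq_left (by nlinarith)]
  -- As `1 < α + β`, a negative coordinate makes the other one exceed one, and then the two `side`
  -- values coincide.
  have hpos : 0 ≤ α ∧ 0 ≤ β := by
    unfold side at hside
    rw [hα', hβ'] at hside
    by_contra hc
    rw [not_and_or, not_le, not_le] at hc
    apply hside
    rcases lt_or_gt_of_ne hD with hD | hD <;> rcases hc with hc | hc
    · rw [if_neg (by nlinarith), if_neg (by nlinarith)]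
    · rw [if_pos (by nlinarith), if_pos (by nlinarith)]
    · rw [if_pos (by nlinarith), if_pos (by nlinarith)]
    · rw [if_neg (by nlinarith), if_neg (by nlinarith)]
  have hs : 0 < α + β := by linarith
  -- The point where the segment from `o` to `q` meets the segment from `a` to `b`.
  refine ⟨o + (α + β)⁻¹ • (q - o), ?_, ?_⟩
  · refine ⟨α / (α + β), β / (α + β), by have := hpos.1; positivity, by have := hpos.2; positivity,
      by field_simp, ?_⟩
    rw [hq]
    apply plane_ext <;>
      · simp only [PiLp.sub_apply, PiLp.add_apply, PiLp.smul_apply, smul_eq_mul]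
        field_simp
        ring
  · rw [dist_eq_norm, dist_eq_norm, add_sub_cancel_left, norm_smul, Real.norm_eq_abs,
      abs_of_pos (inv_pos.2 hs)]
    exact mul_le_of_le_one_left (norm_nonneg _) (inv_le_one_of_one_le₀ hfar.le)

/-- Countably many lines leave a dense set of points. -/
lemma dense_off_lines {ι : Type*} [Countable ι] (a v : ι → Plane) (hv : ∀ i, v i ≠ 0) :
    Dense {o : Plane | ∀ i, cr (v i) (o - a i) ≠ 0} := by
  have : {o : Plane | ∀ i, cr (v i) (o - a i) ≠ 0} = ⋂ i, {o : Plane | cr (v i) (o - a i) ≠ 0} := by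
    ext; simp
  rw [this]
  refine dense_iInter_of_isOpen (fun i => isOpen_ne_fun (continuous_cr _ _) continuous_const)
    fun i => ?_
  intro q
  rw [Metric.mem_closure_iff]
  intro ε hε
  by_cases hq : cr (v i) (q - a i) = 0
  · have hp := perp_ne_zero (hv i)
    have hn : 0 < ‖perp (v i)‖ := norm_pos_iff.2 hp
    refine ⟨q + (ε / 2 / ‖perp (v i)‖) • perp (v i), ?_, ?_⟩
    · have e : q + (ε / 2 / ‖perp (v i)‖) • perp (v i) - a i
          = (q - a i) + (ε / 2 / ‖perp (v i)‖) • perp (v i) := by abel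
      rw [mem_ofPred_eq, e, cr_add, hq, cr_smul, zero_add]
      exact (mul_pos (by positivity) (cr_perp_pos (hv i))).ne'
    · rw [dist_self_add_right, norm_smul, Real.norm_eq_abs, abs_of_pos (by positivity),
        div_mul_cancel₀ _ hn.ne']
      linarith
  · exact ⟨q, hq, by simpa using hε⟩

/-! ### Edge segments, periods and local finiteness -/

namespace PeriodicFramework

variable {V : Type*} {G : SimpleGraph V}

/-- One endpoint of an edge, chosen arbitrarily. -/
noncomputable def tl (e : G.edgeSet) : V := (Quot.out (e : Sym2 V)).1

/-- The other endpoint of an edge. -/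
noncomputable def hd (e : G.edgeSet) : V := (Quot.out (e : Sym2 V)).2

lemma mk_tl_hd (e : G.edgeSet) : s(tl e, hd e) = (e : Sym2 V) := Quot.out_eq (e : Sym2 V)

lemma adj_tl_hd (e : G.edgeSet) : G.Adj (tl e) (hd e) := by
  rw [← SimpleGraph.mem_edgeSet, mk_tl_hd]; exact e.2

lemma tl_hd_cases {e : G.edgeSet} {u v : V} (h : (e : Sym2 V) = s(u, v)) :
    (tl e = u ∧ hd e = v) ∨ (tl e = v ∧ hd e = u) := by
  rw [← mk_tl_hd, Sym2.eq_iff] at h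
  exact h

/-- A symmetric function of the endpoints does not depend on the chosen orientation. -/
lemma apply_tl_hd {X : Type*} (f : V → V → X) (hf : ∀ u v, f u v = f v u) {e : G.edgeSet} {u v : V}
    (h : (e : Sym2 V) = s(u, v)) : f (tl e) (hd e) = f u v := by
  rcases tl_hd_cases h with ⟨h1, h2⟩ | ⟨h1, h2⟩
  · rw [h1, h2]
  · rw [h1, h2, hf]

variable (F : PeriodicFramework G)

/-- The segment of an edge. -/
def seg (e : G.edgeSet) : Set Plane := segment ℝ (F.p (tl e)) (F.p (hd e))

lemma seg_eq {e : G.edgeSet} {u v : V} (h : (e : Sym2 V) = s(u, v)) :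
    F.seg e = segment ℝ (F.p u) (F.p v) :=
  apply_tl_hd (fun u v => segment ℝ (F.p u) (F.p v)) (fun _ _ => segment_symm _ _ _) h

lemma coe_mapEdgeSet (γ : G ≃g G) (e : G.edgeSet) :
    (γ.mapEdgeSet e : Sym2 V) = s(γ (tl e), γ (hd e)) := by
  conv_lhs => rw [show e = ⟨s(tl e, hd e), adj_tl_hd e⟩ from Subtype.ext (mk_tl_hd e).symm]
  rfl

lemma period_mul (γ γ' : F.Γ) : F.period (γ * γ') = F.period γ + F.period γ' := by
  simp [period]

lemma period_one : F.period 1 = 0 := by simp [period]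

lemma period_inv (γ : F.Γ) : F.period γ⁻¹ = -F.period γ := by simp [period]

lemma period_zpow (γ : F.Γ) (k : ℤ) : F.period (γ ^ k) = (k : ℝ) • F.period γ := by
  simp [period, toAdd_zpow, Int.cast_smul_eq_zsmul]

lemma period_injective : Function.Injective F.period := fun _ _ h =>
  F.injective (Multiplicative.toAdd.injective h)

lemma p_apply (γ : F.Γ) (v : V) : F.p ((γ : G ≃g G) v) = F.p v + F.period γ := F.equivariant γ v

lemma mem_seg_mapEdgeSet (γ : F.Γ) (e : G.edgeSet) (x : Plane) :
    x + F.period γ ∈ F.seg ((γ : G ≃g G).mapEdgeSet e) ↔ x ∈ F.seg e := by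
  rw [F.seg_eq (coe_mapEdgeSet (γ : G ≃g G) e), p_apply, p_apply, add_comm x,
    add_comm (F.p (tl e)), add_comm (F.p (hd e)), mem_segment_translate]
  rfl

lemma finite_period (R : ℝ) : {γ : F.Γ | ‖F.period γ‖ ≤ R}.Finite := by
  obtain ⟨b, hb⟩ := F.lattice
  have h := ZSpan.setFinite_inter b (Metric.isBounded_closedBall (x := (0 : Plane)) (r := R))
  refine (h.preimage F.period_injective.injOn).subset fun γ hγ => ⟨by simpa using hγ, ?_⟩
  rw [← hb]
  exact ⟨γ, rfl⟩

/-- Only finitely many edges meet a bounded set. -/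
lemma finite_edges (R : ℝ) : {e : G.edgeSet | ∃ x ∈ F.seg e, ‖x‖ ≤ R}.Finite := by
  obtain ⟨T, hT⟩ := F.finite_edge_orbits
  have hb : Bornology.IsBounded (⋃ f ∈ T, F.seg f) := by
    rw [Bornology.isBounded_biUnion_finset]
    intro f _
    rw [seg, segment_eq_image]
    exact (isCompact_Icc.image (by fun_prop)).isBounded
  obtain ⟨M, hM⟩ := hb.exists_norm_le
  -- `M` bounds the finitely many representative segments, so a translate meeting the disc of radius
  -- `R` has a period of norm at most `R + M`.
  refine (((F.finite_period (R + M)).prod T.finite_toSet).image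
    fun x => ((x.1 : F.Γ) : G ≃g G).mapEdgeSet x.2).subset ?_
  rintro e ⟨x, hx, hxR⟩
  obtain ⟨γ, f, hf, rfl⟩ := hT e
  refine ⟨(γ, f), ⟨?_, hf⟩, rfl⟩
  have h1 : x - F.period γ ∈ F.seg f := by
    rw [← F.mem_seg_mapEdgeSet γ, sub_add_cancel]; exact hx
  have h2 := hM _ (mem_biUnion hf h1)
  have h3 : F.period γ = x - (x - F.period γ) := by abel
  rw [mem_ofPred_eq, h3]
  exact (norm_sub_le _ _).trans (by linarith)

lemma countable_edgeSet (F : PeriodicFramework G) : Countable G.edgeSet := by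
  have : (univ : Set G.edgeSet) = ⋃ n : ℕ, {e | ∃ x ∈ F.seg e, ‖x‖ ≤ n} := by
    refine (eq_univ_of_forall fun e => ?_).symm
    obtain ⟨n, hn⟩ := exists_nat_ge ‖F.p (tl e)‖
    exact mem_iUnion.2 ⟨n, F.p (tl e), left_mem_segment _ _ _, hn⟩
  rw [← countable_univ_iff, this]
  exact countable_iUnion fun n => (F.finite_edges n).countable

lemma exists_period_ne_zero : ∃ γ : F.Γ, F.period γ ≠ 0 := by
  obtain ⟨b, hb⟩ := F.lattice
  have : b 0 ∈ Set.range fun γ : F.Γ => (F.π γ).toAdd := by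
    rw [hb]; exact Submodule.subset_span ⟨0, rfl⟩
  obtain ⟨γ, hγ⟩ := this
  exact ⟨γ, by rw [show F.period γ = b 0 from hγ]; exact b.ne_zero 0⟩

/-- A nonzero period moves `v` to another vertex, and the graph is connected. -/
lemma exists_adj (F : PeriodicFramework G) (v : V) : ∃ w, G.Adj v w := by
  obtain ⟨γ, hγ⟩ := F.exists_period_ne_zero
  have : Nontrivial V := ⟨⟨v, (γ : G ≃g G) v, fun h => hγ (by
    have := F.p_apply γ v
    rw [← h] at this
    simpa using this.symm)⟩⟩
  exact F.connected.preconnected.exists_adj_of_nontrivial v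

lemma exists_edge (F : PeriodicFramework G) (v : V) : ∃ e : G.edgeSet, v ∈ (e : Sym2 V) := by
  obtain ⟨w, hw⟩ := F.exists_adj v
  exact ⟨⟨s(v, w), hw⟩, Sym2.mem_mk_left v w⟩

lemma eq_tl_or_hd {e : G.edgeSet} {v : V} : v ∈ (e : Sym2 V) ↔ v = tl e ∨ v = hd e := by
  rw [← mk_tl_hd e, Sym2.mem_iff]

lemma p_mem_seg {e : G.edgeSet} {v : V} (h : v ∈ (e : Sym2 V)) : F.p v ∈ F.seg e := by
  rcases eq_tl_or_hd.1 h with rfl | rfl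
  · exact left_mem_segment _ _ _
  · exact right_mem_segment _ _ _

lemma countable_vertices (F : PeriodicFramework G) : Countable V := by
  have := F.countable_edgeSet
  choose e he using F.exists_edge
  have h2 : ∀ v, ∃ x : G.edgeSet × Bool, v = if x.2 then tl x.1 else hd x.1 := fun v => by
    rcases eq_tl_or_hd.1 (he v) with h | h
    · exact ⟨(e v, true), by simpa using h⟩
    · exact ⟨(e v, false), by simpa using h⟩
  exact Function.Surjective.countable (f := fun x : G.edgeSet × Bool =>
    if x.2 then tl x.1 else hd x.1) fun v => by
      obtain ⟨x, hx⟩ := h2 v; exact ⟨x, hx.symm⟩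

lemma carrier_eq : F.carrier = ⋃ e, F.seg e := by
  ext q
  simp only [carrier, mem_union, mem_range, mem_ofPred_eq, mem_iUnion]
  constructor
  · rintro (⟨v, rfl⟩ | ⟨u, v, h, hq⟩)
    · obtain ⟨e, he⟩ := F.exists_edge v
      exact ⟨e, F.p_mem_seg he⟩
    · exact ⟨⟨s(u, v), h⟩, by rwa [F.seg_eq rfl]⟩
  · rintro ⟨e, he⟩
    exact Or.inr ⟨tl e, hd e, adj_tl_hd e, he⟩

lemma isClosed_seg (e : G.edgeSet) : IsClosed (F.seg e) := by
  rw [seg, segment_eq_image]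
  exact (isCompact_Icc.image (by fun_prop)).isClosed

lemma locallyFinite_seg : LocallyFinite F.seg := by
  intro q
  refine ⟨Metric.closedBall 0 (‖q‖ + 1), Metric.closedBall_mem_nhds_of_mem (by simp),
    (F.finite_edges (‖q‖ + 1)).subset ?_⟩
  rintro e ⟨x, hx, hxq⟩
  exact ⟨x, hx, by simpa using hxq⟩

lemma isClosed_carrier : IsClosed F.carrier := by
  rw [carrier_eq]
  exact F.locallyFinite_seg.isClosed_iUnion F.isClosed_seg

/-- Near a point there are only the edges passing through the point. -/
lemma eventually_mem_seg (z : Plane) : ∀ᶠ x in 𝓝 z, ∀ e, x ∈ F.seg e → z ∈ F.seg e := by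
  filter_upwards [F.locallyFinite_seg.eventually_subset F.isClosed_seg z] with x hx e he
  exact hx he

variable {F}

lemma IsNonCrossing.eq_of_mem_seg (hF : F.IsNonCrossing) {u v : V} (h : G.Adj u v) {z : Plane}
    (hz : z ∈ openSegment ℝ (F.p u) (F.p v)) {e : G.edgeSet} (he : z ∈ F.seg e) :
    (e : Sym2 V) = s(u, v) := by
  by_contra hne
  have hne' : s(u, v) ≠ s(tl e, hd e) := by rw [mk_tl_hd]; exact fun h => hne h.symm
  obtain ⟨x, hx, rfl⟩ := hF u v (tl e) (hd e) h (adj_tl_hd e) hne'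
    ⟨openSegment_subset_segment _ _ _ hz, he⟩
  rcases hx.1 with rfl | rfl
  · exact F.placement_ne _ _ h (left_mem_openSegment_iff.1 hz)
  · exact F.placement_ne _ _ h (right_mem_openSegment_iff.1 hz)

/-- Compare `e` with an arbitrary edge at `a`: two distinct edges meet only in a common endpoint. -/
lemma IsNonCrossing.mem_of_p_mem_seg (hF : F.IsNonCrossing) {a : V} {e : G.edgeSet}
    (he : F.p a ∈ F.seg e) : a ∈ (e : Sym2 V) := by
  obtain ⟨w, hw⟩ := F.exists_adj a
  by_cases hne : s(a, w) = s(tl e, hd e)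
  · rw [← mk_tl_hd, ← hne]; exact Sym2.mem_mk_left a w
  obtain ⟨x, hx, hxa⟩ := hF a w (tl e) (hd e) hw (adj_tl_hd e) hne ⟨left_mem_segment _ _ _, he⟩
  rcases hx.1 with rfl | rfl
  · rw [eq_tl_or_hd]; exact hx.2
  · exact absurd hxa.symm (F.placement_ne _ _ hw)

/-- Near a point of an open edge segment, the carrier is contained in the line of the edge. -/
lemma IsNonCrossing.eventually_notMem_carrier (hF : F.IsNonCrossing) {u v : V} (h : G.Adj u v)
    {z : Plane} (hz : z ∈ openSegment ℝ (F.p u) (F.p v)) :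
    ∀ᶠ x in 𝓝 z, cr (F.p v - F.p u) (x - F.p u) ≠ 0 → x ∉ F.carrier := by
  filter_upwards [F.eventually_mem_seg z] with x hx hne hxc
  rw [carrier_eq, mem_iUnion] at hxc
  obtain ⟨e, he⟩ := hxc
  have := hF.eq_of_mem_seg h hz (hx e he)
  rw [F.seg_eq this] at he
  exact hne (cr_eq_zero_of_mem_segment he)

/-- A point of the carrier which is not a vertex lies on an open edge segment. -/
lemma mem_openSegment_of_mem_carrier {z : Plane} (hz : z ∈ F.carrier) (hv : z ∉ Set.range F.p) :
    ∃ u v, G.Adj u v ∧ z ∈ openSegment ℝ (F.p u) (F.p v) := by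
  rw [carrier_eq, mem_iUnion] at hz
  obtain ⟨e, he⟩ := hz
  exact ⟨tl e, hd e, adj_tl_hd e, mem_openSegment_of_ne_left_right
    (fun h => hv ⟨_, h⟩) (fun h => hv ⟨_, h⟩) he⟩

end PeriodicFramework

/-! ### Half-neighbourhoods of a point on a line -/

lemma cr_reverse (a b x : Plane) : cr (a - b) (x - b) = -cr (b - a) (x - a) := by
  simp only [cr, PiLp.sub_apply]; ring

lemma tendsto_add_smul_perp (z v : Plane) :
    Tendsto (fun t : ℝ => z + t • perp v) (𝓝[>] 0) (𝓝 z) := by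
  have : Tendsto (fun t : ℝ => z + t • perp v) (𝓝 0) (𝓝 (z + (0:ℝ) • perp v)) :=
    Continuous.tendsto (by fun_prop) 0
  simpa using this.mono_left nhdsWithin_le_nhds

lemma cr_add_smul_perp {a v z : Plane} (hz : cr v (z - a) = 0) (t : ℝ) :
    cr v (z + t • perp v - a) = t * cr v (perp v) := by
  rw [show z + t • perp v - a = (z - a) + t • perp v by abel, cr_add, hz, cr_smul, zero_add]

lemma eventually_left {a v z : Plane} (hv : v ≠ 0) (hz : cr v (z - a) = 0) {P : Plane → Prop}
    (h : ∀ᶠ x in 𝓝 z, 0 < cr v (x - a) → P x) : ∀ᶠ t : ℝ in 𝓝[>] 0, P (z + t • perp v) := by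
  filter_upwards [(tendsto_add_smul_perp z v).eventually h, self_mem_nhdsWithin] with t ht h0
  exact ht (by rw [cr_add_smul_perp hz]; exact mul_pos h0 (cr_perp_pos hv))

lemma exists_left {a v z : Plane} (hv : v ≠ 0) (hz : cr v (z - a) = 0) {P : Plane → Prop}
    (h : ∀ᶠ x in 𝓝 z, P x) : ∃ x, 0 < cr v (x - a) ∧ P x := by
  obtain ⟨t, ht, h0⟩ := ((((tendsto_add_smul_perp z v).eventually h).and
    self_mem_nhdsWithin)).exists
  exact ⟨_, by rw [cr_add_smul_perp hz]; exact mul_pos h0 (cr_perp_pos hv), ht⟩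

/-- A point of the boundary line close to `z` is a limit, along `perp v`, of points where the two
functions agree. -/
lemma eventually_eq_closed_half {a v z : Plane} (hv : v ≠ 0) {f g : Plane → ℝ} (hf : Continuous f)
    (hg : Continuous g) (h : ∀ᶠ x in 𝓝 z, 0 < cr v (x - a) → f x = g x) :
    ∀ᶠ x in 𝓝 z, 0 ≤ cr v (x - a) → f x = g x := by
  filter_upwards [h.eventually_nhds] with x hx h0
  rcases h0.lt_or_eq with h0 | h0
  · exact hx.self_of_nhds h0
  · have ht := tendsto_add_smul_perp x v
    refine tendsto_nhds_unique ((hf.tendsto x).comp ht)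
      (((hg.tendsto x).comp ht).congr' ?_)
    filter_upwards [eventually_left hv h0.symm hx] with t h1 using h1.symm

lemma affine_unique_half {a v z ν ν' : Plane} {C C' : ℝ} (hv : v ≠ 0) (hz : cr v (z - a) = 0)
    (h : ∀ᶠ x in 𝓝 z, 0 < cr v (x - a) → inner ℝ ν x + C = inner ℝ ν' x + C') :
    ν = ν' ∧ C = C' := by
  obtain ⟨x, hx, hx'⟩ := exists_left hv hz h.eventually_nhds
  refine affine_unique_of_eventually (q := x) ?_
  filter_upwards [hx', (continuous_cr v a).continuousAt.eventually_const_lt hx] with y hy h0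
  exact hy h0

/-! ### Kinks, gradient jumps and convexity -/

/-- The gradients on the two sides of a kink. -/
lemma KinkAt.jump {H : Plane → ℝ} {a b z νU νW : Plane} {σ CU CW : ℝ} (hab : a ≠ b)
    (hz : cr (b - a) (z - a) = 0) (hk : KinkAt H a (b - a) σ z)
    (hW : ∀ᶠ x in 𝓝 z, 0 < cr (b - a) (x - a) → H x = inner ℝ νW x + CW)
    (hU : ∀ᶠ x in 𝓝 z, 0 < cr (a - b) (x - b) → H x = inner ℝ νU x + CU) :
    νW - νU = σ • perp (b - a) := by
  obtain ⟨ν, C, hν⟩ := hk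
  have hv : b - a ≠ 0 := sub_ne_zero.2 hab.symm
  have h1 : νU = ν ∧ CU = C := by
    refine affine_unique_half (a := b) (v := a - b) (z := z) (sub_ne_zero.2 hab)
      (by rw [cr_reverse, hz, neg_zero]) ?_
    filter_upwards [hν, hU] with x h1 h2 h3
    rw [cr_reverse] at h3
    rw [← h2 (by rwa [cr_reverse]), ← h1, max_eq_left (by linarith)]; ring
  have h2 : νW = ν + σ • perp (b - a) ∧ CW = C - σ * cr (b - a) a := by
    refine affine_unique_half hv hz ?_
    filter_upwards [hν, hW] with x h1 h2 h3
    rw [← h2 h3]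
    rw [max_eq_right h3.le] at h1
    rw [inner_add_left, inner_smul_left, inner_perp]
    rw [cr_sub] at h1
    simp only [conj_trivial]
    linear_combination h1
  rw [h2.1, h1.1]; abel

/-- A continuous function which is affine on both sides of a line has a kink there. -/
lemma kinkAt_of_jump {H : Plane → ℝ} (hH : Continuous H) {a b z νU νW : Plane} {σ CU CW : ℝ}
    (hab : a ≠ b) (hz : cr (b - a) (z - a) = 0)
    (hW : ∀ᶠ x in 𝓝 z, 0 < cr (b - a) (x - a) → H x = inner ℝ νW x + CW)
    (hU : ∀ᶠ x in 𝓝 z, 0 < cr (a - b) (x - b) → H x = inner ℝ νU x + CU)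
    (hσ : νW - νU = σ • perp (b - a)) : KinkAt H a (b - a) σ z := by
  have hv : b - a ≠ 0 := sub_ne_zero.2 hab.symm
  have hW' := eventually_eq_closed_half hv hH (by fun_prop) hW
  have hU' := eventually_eq_closed_half (sub_ne_zero.2 hab) hH (by fun_prop) hU
  have hC : inner ℝ νW z + CW = inner ℝ νU z + CU := by
    rw [← hW'.self_of_nhds hz.ge,
      ← hU'.self_of_nhds (by rw [cr_reverse, hz, neg_zero])]
  refine ⟨νU, CU, ?_⟩
  have hνW : νW = νU + σ • perp (b - a) := by rw [← hσ]; abel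
  filter_upwards [hW', hU'] with x h1 h2
  rcases le_total 0 (cr (b - a) (x - a)) with h | h
  · rw [h1 h, max_eq_right h]
    rw [hνW] at hC ⊢
    rw [inner_add_left, inner_smul_left, inner_perp] at hC ⊢
    rw [cr_sub] at hz ⊢
    simp only [conj_trivial] at hC ⊢
    linear_combination hC - σ * hz
  · rw [h2 (by rw [cr_reverse]; linarith), max_eq_left h]; ring

lemma eq_zero_of_affAt_max {a b z : Plane} {c : ℝ} (hab : a ≠ b) (hz : cr (b - a) (z - a) = 0)
    (h : AffAt (fun x => c * max 0 (cr (b - a) (x - a))) z) : c = 0 := by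
  obtain ⟨ν, C, h⟩ := h
  have := KinkAt.jump (H := fun x => c * max 0 (cr (b - a) (x - a))) (νU := ν) (νW := ν) (CU := C)
    (CW := C) (σ := c) hab hz ((affAt_const 0 z).congr (Eventually.of_forall fun x => by ring))
    (by filter_upwards [h] with x hx _ using hx) (by filter_upwards [h] with x hx _ using hx)
  rw [sub_self] at this
  exact (smul_eq_zero.1 this.symm).resolve_right (perp_ne_zero (sub_ne_zero.2 hab.symm))

lemma convexOn_affine (ν : Plane) (C : ℝ) {s : Set Plane} (hs : Convex ℝ s) :
    ConvexOn ℝ s fun x => inner ℝ ν x + C := by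
  refine ⟨hs, fun x _ y _ α β _ _ hαβ => le_of_eq ?_⟩
  simp only [inner_add_right, inner_smul_right, smul_eq_mul]
  linear_combination (-C) * hαβ

lemma convexOn_max_cr (a v : Plane) {s : Set Plane} (hs : Convex ℝ s) :
    ConvexOn ℝ s fun x => max 0 (cr v (x - a)) := by
  have h := convexOn_affine (perp v) (-cr v a) hs
  refine (convexOn_const 0 hs).sup (h.congr fun x _ => ?_)
  simp only [inner_perp, cr_sub]; ring

lemma KinkAt.exists_convexOn {H : Plane → ℝ} {a v z : Plane} {σ : ℝ} (hk : KinkAt H a v σ z)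
    (hσ : 0 ≤ σ) : ∃ ε > 0, ConvexOn ℝ (Metric.ball z ε) H := by
  obtain ⟨ν, C, hν⟩ := hk
  obtain ⟨ε, hε, hb⟩ := Metric.eventually_nhds_iff_ball.1 hν
  have hc := convex_ball z ε
  refine ⟨ε, hε, ((convexOn_affine ν C hc).add ((convexOn_max_cr a v hc).smul hσ)).congr
    fun x hx => ?_⟩
  have := hb x hx
  simp only [Pi.add_apply, smul_eq_mul]
  linarith

lemma KinkAt.neg {H : Plane → ℝ} {a v z : Plane} {σ : ℝ} (hk : KinkAt H a v σ z) :
    KinkAt (-H) a v (-σ) z :=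
  (AffAt.neg hk).congr (Eventually.of_forall fun x => by simp only [Pi.neg_apply]; ring)

/-- The second difference of `H` across the line, with step `t • perp v`, is `σ * (t * cr v (perp
v))`; midpoint convexity makes it nonnegative. -/
lemma KinkAt.nonneg_of_convexOn {H : Plane → ℝ} {a v z : Plane} {σ ε : ℝ} (hv : v ≠ 0)
    (hz : cr v (z - a) = 0) (hk : KinkAt H a v σ z) (hε : 0 < ε)
    (hc : ConvexOn ℝ (Metric.ball z ε) H) : 0 ≤ σ := by
  obtain ⟨ν, C, hν⟩ := hk
  beta_reduce at hν
  have h1 : Tendsto (fun t : ℝ => z + (-t) • perp v) (𝓝[>] 0) (𝓝 z) := by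
    have : Tendsto (fun t : ℝ => z + (-t) • perp v) (𝓝 0) (𝓝 (z + (-0:ℝ) • perp v)) :=
      Continuous.tendsto (by fun_prop) 0
    simpa using this.mono_left nhdsWithin_le_nhds
  have h2 := tendsto_add_smul_perp z v
  have h3 := hν.and (Metric.ball_mem_nhds z hε)
  obtain ⟨t, ⟨⟨e1, m1⟩, ⟨e2, m2⟩⟩, ht⟩ :=
    (((h1.eventually h3).and (h2.eventually h3)).and self_mem_nhdsWithin).exists
  have hpos := cr_perp_pos hv
  have ht : 0 < t := ht
  have e0 := hν.self_of_nhds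
  have hmid := hc.2 m1 m2 (by norm_num : (0 : ℝ) ≤ 1 / 2) (by norm_num : (0 : ℝ) ≤ 1 / 2)
    (by norm_num)
  have hz' : (1 / 2 : ℝ) • (z + -t • perp v) + (1 / 2 : ℝ) • (z + t • perp v) = z := by module
  rw [hz', smul_eq_mul, smul_eq_mul] at hmid
  rw [cr_add_smul_perp hz, inner_add_right, inner_smul_right] at e1 e2
  rw [max_eq_left (by nlinarith)] at e1
  rw [max_eq_right (by positivity)] at e2
  rw [hz, max_self] at e0
  have h4 : 0 ≤ σ * (t * cr v (perp v)) := by linarith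
  exact nonneg_of_mul_nonneg_left h4 (by positivity)

namespace PeriodicFramework

variable {V : Type*} {G : SimpleGraph V} {F : PeriodicFramework G}

/-! ### Faces -/

lemma IsFace.isOpen {U : Set Plane} (hU : F.IsFace U) : IsOpen U := by
  obtain ⟨q, -, rfl⟩ := hU
  exact F.isClosed_carrier.isOpen_compl.connectedComponentIn

lemma IsFace.isPreconnected {U : Set Plane} (hU : F.IsFace U) : IsPreconnected U := by
  obtain ⟨q, -, rfl⟩ := hU
  exact isPreconnected_connectedComponentIn

lemma IsFace.subset {U : Set Plane} (hU : F.IsFace U) : U ⊆ F.carrierᶜ := by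
  obtain ⟨q, -, rfl⟩ := hU
  exact connectedComponentIn_subset _ _

lemma IsFace.eq_component {U : Set Plane} (hU : F.IsFace U) {x : Plane} (hx : x ∈ U) :
    U = connectedComponentIn F.carrierᶜ x := by
  obtain ⟨q, -, rfl⟩ := hU
  exact connectedComponentIn_eq hx

lemma IsFace.eq {U W : Set Plane} (hU : F.IsFace U) (hW : F.IsFace W) {x : Plane} (hx : x ∈ U)
    (hx' : x ∈ W) : U = W := by
  rw [hU.eq_component hx, hW.eq_component hx']

lemma IsFace.superset {U S : Set Plane} (hU : F.IsFace U) (hS : IsPreconnected S)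
    (hSc : S ⊆ F.carrierᶜ) {x : Plane} (hxS : x ∈ S) (hxU : x ∈ U) : S ⊆ U := by
  rw [hU.eq_component hxU]
  exact hS.subset_connectedComponentIn hxS hSc

lemma exists_face {q : Plane} (hq : q ∉ F.carrier) : ∃ U, F.IsFace U ∧ q ∈ U :=
  ⟨_, ⟨q, hq, rfl⟩, mem_connectedComponentIn hq⟩

lemma sub_ne_zero_of_adj {u v : V} (h : G.Adj u v) : F.p v - F.p u ≠ 0 :=
  sub_ne_zero.2 (F.placement_ne _ _ h).symm

lemma cr_of_mem_openSegment {a b z : Plane} (hz : z ∈ openSegment ℝ a b) :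
    cr (b - a) (z - a) = 0 :=
  cr_eq_zero_of_mem_segment (openSegment_subset_segment _ _ _ hz)

/-- A small open half-disc on the left of the edge works: it is convex, and close to `z` the carrier
stays within the line of the edge. -/
lemma exists_half_neighbourhood (hF : F.IsNonCrossing) {u v : V} (h : G.Adj u v) {z : Plane}
    (hz : z ∈ openSegment ℝ (F.p u) (F.p v)) : ∃ S ⊆ F.carrierᶜ, IsPreconnected S ∧
      ∀ᶠ x in 𝓝 z, 0 < cr (F.p v - F.p u) (x - F.p u) → x ∈ S := by
  obtain ⟨ε, hε, hb⟩ := Metric.eventually_nhds_iff_ball.1 (hF.eventually_notMem_carrier h hz)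
  refine ⟨Metric.ball z ε ∩ {x | 0 < cr (F.p v - F.p u) (x - F.p u)},
    fun x hx => hb x hx.1 (ne_of_gt hx.2), ((convex_ball z ε).inter ?_).isPreconnected,
    by filter_upwards [Metric.ball_mem_nhds z hε] with x hx h0 using ⟨hx, h0⟩⟩
  intro x hx y hy α β hα hβ hαβ
  have e : α • x + β • y - F.p u = α • (x - F.p u) + β • (y - F.p u) := by
    have : F.p u = α • F.p u + β • F.p u := by rw [← add_smul, hαβ, one_smul]
    nth_rewrite 1 [this]
    module
  rw [mem_ofPred_eq, e, cr_add, cr_smul, cr_smul]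
  have hx : 0 < cr (F.p v - F.p u) (x - F.p u) := hx
  have hy : 0 < cr (F.p v - F.p u) (y - F.p u) := hy
  rcases hα.lt_or_eq with h0 | h0
  · have := mul_pos h0 hx
    have := mul_nonneg hβ hy.le
    linarith
  · have : β = 1 := by linarith
    rw [← h0, this]; linarith

/-- A single point of the face in a connected half-neighbourhood puts all of it into the face, so
testing along the normal is enough. -/
lemma isLeftFace_iff (hF : F.IsNonCrossing) {u v : V} (h : G.Adj u v) (U : Set Plane) :
    F.IsLeftFace u v U ↔ F.IsFace U ∧ ∀ z ∈ openSegment ℝ (F.p u) (F.p v),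
      ∀ᶠ x in 𝓝 z, 0 < cr (F.p v - F.p u) (x - F.p u) → x ∈ U := by
  refine and_congr_right fun hU => forall₂_congr fun z hz => ?_
  have hz0 := cr_of_mem_openSegment hz
  refine ⟨fun h1 => ?_, fun h1 => eventually_left (sub_ne_zero_of_adj h) hz0 h1⟩
  obtain ⟨S, hSc, hS, hSz⟩ := exists_half_neighbourhood hF h hz
  obtain ⟨t, htU, htS⟩ := (h1.and (eventually_left (sub_ne_zero_of_adj h) hz0 hSz)).exists
  filter_upwards [hSz] with x hx h0
  exact hU.superset hS hSc htS htU (hx h0)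

/-- Each point of the open edge has a face on its left. Half-neighbourhoods of nearby points
overlap, so this face is locally constant along the connected open segment. -/
lemma exists_isLeftFace (hF : F.IsNonCrossing) {u v : V} (h : G.Adj u v) :
    ∃ U, F.IsLeftFace u v U := by
  have hv := sub_ne_zero_of_adj (F := F) h
  have hex : ∀ z ∈ openSegment ℝ (F.p u) (F.p v), ∃ U, F.IsFace U ∧
      ∀ᶠ x in 𝓝 z, 0 < cr (F.p v - F.p u) (x - F.p u) → x ∈ U := by
    intro z hz
    obtain ⟨S, hSc, hS, hSz⟩ := exists_half_neighbourhood hF h hz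
    obtain ⟨x, hx0, hxS⟩ := exists_left hv (cr_of_mem_openSegment hz) hSz
    obtain ⟨U, hU, hxU⟩ := exists_face (hSc (hxS hx0))
    refine ⟨U, hU, ?_⟩
    filter_upwards [hSz] with y hy h0
    exact hU.superset hS hSc (hxS hx0) hxU (hy h0)
  choose! φ hφ hφ' using hex
  have : PreconnectedSpace (openSegment ℝ (F.p u) (F.p v)) :=
    Subtype.preconnectedSpace (convex_openSegment _ _).isPreconnected
  have hloc : IsLocallyConstant fun z : openSegment ℝ (F.p u) (F.p v) => φ z := by
    rw [IsLocallyConstant.iff_eventually_eq]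
    intro z
    have h1 : ∀ᶠ y : openSegment ℝ (F.p u) (F.p v) in 𝓝 z, ∀ᶠ x in 𝓝 (y : Plane),
        0 < cr (F.p v - F.p u) (x - F.p u) → x ∈ φ z :=
      continuous_subtype_val.continuousAt.eventually (hφ' z z.2).eventually_nhds
    filter_upwards [h1] with y hy
    obtain ⟨x, hx0, hx1, hx2⟩ := exists_left hv (cr_of_mem_openSegment y.2) (hy.and (hφ' y y.2))
    exact (hφ y y.2).eq (hφ z z.2) (hx2 hx0) (hx1 hx0)
  obtain ⟨z₀, hz₀⟩ : (openSegment ℝ (F.p u) (F.p v)).Nonempty :=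
    ⟨_, 1 / 2, 1 / 2, by norm_num, by norm_num, by norm_num, rfl⟩
  refine ⟨φ z₀, (isLeftFace_iff hF h _).2 ⟨hφ z₀ hz₀, fun z hz => ?_⟩⟩
  have := hloc.apply_eq_of_preconnectedSpace ⟨z₀, hz₀⟩ ⟨z, hz⟩
  simp only at this
  rw [this]
  exact hφ' z hz

lemma exists_isTetrad (hF : F.IsNonCrossing) {u v : V} (h : G.Adj u v) :
    ∃ U W, F.IsTetrad u v U W := by
  obtain ⟨U, hU⟩ := exists_isLeftFace hF h.symm
  obtain ⟨W, hW⟩ := exists_isLeftFace hF h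
  exact ⟨U, W, hU, hW⟩

lemma exists_mem_openSegment (a b : Plane) : ∃ z, z ∈ openSegment ℝ a b :=
  ⟨_, 1 / 2, 1 / 2, by norm_num, by norm_num, by norm_num, rfl⟩

/-! ### Liftings as functions with prescribed kinks -/

variable (F) in
/-- A continuous function, locally affine off the placed graph, with kinks of strength `s` along
the edges. -/
def HasKinks (H : Plane → ℝ) (s : G.edgeSet → ℝ) : Prop :=
  Continuous H ∧ (∀ q ∉ F.carrier, AffAt H q) ∧
    ∀ (u v : V) (h : G.Adj u v), ∀ q ∈ openSegment ℝ (F.p u) (F.p v),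
      KinkAt H (F.p u) (F.p v - F.p u) (s ⟨s(u, v), h⟩) q

lemma hasKinks_of_tl_hd {H : Plane → ℝ} {s : G.edgeSet → ℝ} (hH : Continuous H)
    (h0 : ∀ q ∉ F.carrier, AffAt H q)
    (h1 : ∀ e : G.edgeSet, ∀ q ∈ openSegment ℝ (F.p (tl e)) (F.p (hd e)),
      KinkAt H (F.p (tl e)) (F.p (hd e) - F.p (tl e)) (s e) q) : F.HasKinks H s := by
  refine ⟨hH, h0, fun u v h q hq => ?_⟩
  have h2 := h1 ⟨s(u, v), h⟩ q
  rcases tl_hd_cases (e := ⟨s(u, v), h⟩) rfl with ⟨e1, e2⟩ | ⟨e1, e2⟩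
  · rw [e1, e2] at h2
    exact h2 hq
  · rw [e1, e2, openSegment_symm] at h2
    exact (h2 hq).reverse

lemma IsLifting.affAt {H : Plane → ℝ} (hH : F.IsLifting H) {q : Plane} (hq : q ∉ F.carrier) :
    AffAt H q := by
  obtain ⟨U, hU, hqU⟩ := exists_face hq
  obtain ⟨ν, C, h⟩ := hH.2 U hU
  exact ⟨ν, C, by filter_upwards [hU.isOpen.mem_nhds hqU] with x hx using h x hx⟩

lemma IsLeftFace.eventually_eq_form (hF : F.IsNonCrossing) {u v : V} (h : G.Adj u v)
    {H : Plane → ℝ} {U : Set Plane} {ν : Plane} {C : ℝ} (hU : F.IsLeftFace u v U)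
    (hf : HasAffineForm H U ν C) {z : Plane} (hz : z ∈ openSegment ℝ (F.p u) (F.p v)) :
    ∀ᶠ x in 𝓝 z, 0 < cr (F.p v - F.p u) (x - F.p u) → H x = inner ℝ ν x + C := by
  filter_upwards [((isLeftFace_iff hF h U).1 hU).2 z hz] with x hx h0 using hf x (hx h0)

lemma HasKinks.jump (hF : F.IsNonCrossing) {H : Plane → ℝ} {s : G.edgeSet → ℝ}
    (hk : F.HasKinks H s) {u v : V} (h : G.Adj u v) {U W : Set Plane} {νU νW : Plane} {CU CW : ℝ}
    (ht : F.IsTetrad u v U W) (hU : HasAffineForm H U νU CU) (hW : HasAffineForm H W νW CW) :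
    νW - νU = s ⟨s(u, v), h⟩ • perp (F.p v - F.p u) := by
  obtain ⟨z, hz⟩ := exists_mem_openSegment (F.p u) (F.p v)
  exact KinkAt.jump (F.placement_ne _ _ h) (cr_of_mem_openSegment hz) (hk.2.2 u v h z hz)
    (IsLeftFace.eventually_eq_form hF h ht.2 hW hz)
    (IsLeftFace.eventually_eq_form hF h.symm ht.1 hU (by rwa [openSegment_symm]))

lemma HasKinks.isLifting {H : Plane → ℝ} {s : G.edgeSet → ℝ} (hk : F.HasKinks H s) :
    F.IsLifting H :=
  ⟨hk.1, fun _ hU => exists_affine_of_affAt hU.isPreconnected fun q hq => hk.2.1 q (hU.subset hq)⟩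

lemma HasKinks.induces (hF : F.IsNonCrossing) {H : Plane → ℝ} {s : G.edgeSet → ℝ}
    (hk : F.HasKinks H s) : F.Induces H s := by
  intro u v h
  obtain ⟨U, W, ht⟩ := exists_isTetrad hF h
  obtain ⟨νU, CU, hU⟩ := hk.isLifting.2 U ht.1.1
  obtain ⟨νW, CW, hW⟩ := hk.isLifting.2 W ht.2.1
  exact ⟨U, W, νU, νW, CU, CW, ht, hU, hW, hk.jump hF h ht hU hW⟩

lemma IsLifting.hasKinks (hF : F.IsNonCrossing) {H : Plane → ℝ} {s : G.edgeSet → ℝ}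
    (hH : F.IsLifting H) (hs : F.Induces H s) : F.HasKinks H s := by
  refine ⟨hH.1, fun q hq => hH.affAt hq, fun u v h z hz => ?_⟩
  obtain ⟨U, W, νU, νW, CU, CW, ht, hU, hW, hσ⟩ := hs u v h
  exact kinkAt_of_jump hH.1 (F.placement_ne _ _ h) (cr_of_mem_openSegment hz)
    (IsLeftFace.eventually_eq_form hF h ht.2 hW hz)
    (IsLeftFace.eventually_eq_form hF h.symm ht.1 hU (by rwa [openSegment_symm])) hσ

/-- The two affine forms next to an edge agree on the edge. -/
lemma IsLifting.affine_forms_agree (hF : F.IsNonCrossing) {H : Plane → ℝ} (hH : F.IsLifting H)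
    {u v : V} (h : G.Adj u v) {U W : Set Plane} {νU νW : Plane} {CU CW : ℝ}
    (ht : F.IsTetrad u v U W) (hU : HasAffineForm H U νU CU) (hW : HasAffineForm H W νW CW)
    {z : Plane} (hz : z ∈ openSegment ℝ (F.p u) (F.p v)) :
    inner ℝ νW z + CW = inner ℝ νU z + CU := by
  have hne := F.placement_ne _ _ h
  have h1 := eventually_eq_closed_half (sub_ne_zero.2 hne.symm) hH.1 (by fun_prop)
    (IsLeftFace.eventually_eq_form hF h ht.2 hW hz)
  have h2 := eventually_eq_closed_half (sub_ne_zero.2 hne) hH.1 (by fun_prop)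
    (IsLeftFace.eventually_eq_form hF h.symm ht.1 hU (by rwa [openSegment_symm]))
  have h0 := cr_of_mem_openSegment hz
  rw [← h1.self_of_nhds h0.ge, ← h2.self_of_nhds (by rw [cr_reverse, h0, neg_zero])]

lemma IsLifting.exists_hasKinks (hF : F.IsNonCrossing) {H : Plane → ℝ} (hH : F.IsLifting H) :
    ∃ s, F.HasKinks H s := by
  have key : ∀ e : G.edgeSet, ∃ σ : ℝ, ∀ q ∈ openSegment ℝ (F.p (tl e)) (F.p (hd e)),
      KinkAt H (F.p (tl e)) (F.p (hd e) - F.p (tl e)) σ q := by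
    intro e
    have h := adj_tl_hd e
    have hne := F.placement_ne _ _ h
    obtain ⟨U, W, ht⟩ := exists_isTetrad hF h
    obtain ⟨νU, CU, hU⟩ := hH.2 U ht.1.1
    obtain ⟨νW, CW, hW⟩ := hH.2 W ht.2.1
    have hag := fun z hz => hH.affine_forms_agree hF h ht hU hW (z := z) hz
    simp only [openSegment_eq_image', mem_image, forall_exists_index, and_imp] at hag
    -- Agreement at two points of the edge makes the gradient difference orthogonal to it. The
    -- parameters 1/2 and 1/3 differ by 1/6, whence the factor 6 below.
    have e1 := hag _ (1 / 2) (by norm_num) rfl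
    have e2 := hag _ (1 / 3) (by norm_num) rfl
    obtain ⟨σ, hσ⟩ : ∃ σ : ℝ, νW - νU = σ • perp (F.p (hd e) - F.p (tl e)) := by
      refine exists_smul_perp (sub_ne_zero.2 hne.symm) ?_
      rw [inner_add_right, inner_add_right, inner_smul_right, inner_smul_right] at e1 e2
      rw [inner_sub_left]
      linear_combination 6 * e1 - 6 * e2
    exact ⟨σ, fun z hz => kinkAt_of_jump hH.1 hne (cr_of_mem_openSegment hz)
      (IsLeftFace.eventually_eq_form hF h ht.2 hW hz)
      (IsLeftFace.eventually_eq_form hF h.symm ht.1 hU (by rwa [openSegment_symm])) hσ⟩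
  choose s hs using key
  exact ⟨s, hasKinks_of_tl_hd hH.1 (fun q hq => hH.affAt hq) hs⟩

/-- Otherwise a fold with nonzero coefficient `s e - s' e` would be affine near a point of its line.
-/
lemma HasKinks.unique {H : Plane → ℝ} {s s' : G.edgeSet → ℝ} (hk : F.HasKinks H s)
    (hk' : F.HasKinks H s') : s = s' := by
  funext e
  obtain ⟨z, hz⟩ := exists_mem_openSegment (F.p (tl e)) (F.p (hd e))
  have h1 := hk.2.2 _ _ (adj_tl_hd e) z hz
  have h2 := hk'.2.2 _ _ (adj_tl_hd e) z hz
  have he : (⟨s(tl e, hd e), adj_tl_hd e⟩ : G.edgeSet) = e := Subtype.ext (mk_tl_hd e)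
  rw [he] at h1 h2
  have := eq_zero_of_affAt_max (c := s e - s' e) (F.placement_ne _ _ (adj_tl_hd e))
    (cr_of_mem_openSegment hz)
    ((AffAt.sub h2 h1).congr (Eventually.of_forall fun x => by ring))
  linarith

/-- Two functions with the same kinks differ by an affine function. -/
lemma HasKinks.exists_affine_sub {f g : Plane → ℝ} {s : G.edgeSet → ℝ} (hf : F.HasKinks f s)
    (hg : F.HasKinks g s) : ∃ (ν : Plane) (C : ℝ), ∀ q, f q = g q + (inner ℝ ν q + C) := by
  have := F.countable_vertices
  -- Off the vertices the difference is locally affine: the kinks cancel on open edges. The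
  -- countable set of vertices does not disconnect the plane.
  obtain ⟨ν, C, h⟩ := exists_affine_of_countable (countable_range F.p) (hf.1.sub hg.1)
    fun q hq => by
      by_cases hc : q ∈ F.carrier
      · obtain ⟨u, v, h, hz⟩ := mem_openSegment_of_mem_carrier hc hq
        exact (hf.2.2 u v h q hz).affAt_sub (hg.2.2 u v h q hz)
      · exact (hf.2.1 q hc).sub (hg.2.1 q hc)
  exact ⟨ν, C, fun q => by rw [← h q, Pi.sub_apply]; ring⟩

lemma HasKinks.add_affine {f : Plane → ℝ} {s : G.edgeSet → ℝ} (hf : F.HasKinks f s) (ν : Plane)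
    (C : ℝ) : F.HasKinks (fun q => f q + (inner ℝ ν q + C)) s :=
  ⟨hf.1.add (by fun_prop), fun q hq => (hf.2.1 q hq).add (affAt_of_affine (fun _ => rfl) q),
    fun u v h q hq => (hf.2.2 u v h q hq).add_affAt (affAt_of_affine (fun _ => rfl) q)⟩

/-! ### Signs of the kinks -/

lemma HasKinks.eq_zero_iff_isFlatEdge (hF : F.IsNonCrossing) {H : Plane → ℝ} {s : G.edgeSet → ℝ}
    (hk : F.HasKinks H s) {u v : V} (h : G.Adj u v) :
    s ⟨s(u, v), h⟩ = 0 ↔ F.IsFlatEdge H u v := by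
  constructor
  · intro h0
    obtain ⟨U, W, νU, νW, CU, CW, ht, hU, hW, hσ⟩ := hk.induces hF u v h
    rw [h0, zero_smul, sub_eq_zero] at hσ
    obtain ⟨z, hz⟩ := exists_mem_openSegment (F.p u) (F.p v)
    have := hk.isLifting.affine_forms_agree hF h ht hU hW hz
    rw [hσ] at this hW
    exact ⟨U, W, νU, CU, ht, hU, by rwa [← add_left_cancel this]⟩
  · rintro ⟨U, W, ν, C, ht, hU, hW⟩
    have := hk.jump hF h ht hU hW
    rw [sub_self] at this
    exact (smul_eq_zero.1 this.symm).resolve_right (perp_ne_zero (sub_ne_zero_of_adj h))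

lemma HasKinks.pos_iff_isValleyEdge (hF : F.IsNonCrossing) {H : Plane → ℝ} {s : G.edgeSet → ℝ}
    (hk : F.HasKinks H s) {u v : V} (h : G.Adj u v) :
    0 < s ⟨s(u, v), h⟩ ↔ F.IsValleyEdge H u v := by
  rw [IsValleyEdge, ← hk.eq_zero_iff_isFlatEdge hF h]
  constructor
  · exact fun h0 => ⟨h0.ne', fun q hq => (hk.2.2 u v h q hq).exists_convexOn h0.le⟩
  · rintro ⟨hne, hc⟩
    obtain ⟨z, hz⟩ := exists_mem_openSegment (F.p u) (F.p v)
    obtain ⟨ε, hε, hc⟩ := hc z hz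
    exact lt_of_le_of_ne' ((hk.2.2 u v h z hz).nonneg_of_convexOn (sub_ne_zero_of_adj h)
      (cr_of_mem_openSegment hz) hε hc) hne

lemma HasKinks.neg_iff_isMountainEdge (hF : F.IsNonCrossing) {H : Plane → ℝ} {s : G.edgeSet → ℝ}
    (hk : F.HasKinks H s) {u v : V} (h : G.Adj u v) :
    s ⟨s(u, v), h⟩ < 0 ↔ F.IsMountainEdge H u v := by
  rw [IsMountainEdge, ← hk.eq_zero_iff_isFlatEdge hF h]
  constructor
  · refine fun h0 => ⟨h0.ne, fun q hq => ?_⟩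
    obtain ⟨ε, hε, hc⟩ := (hk.2.2 u v h q hq).neg.exists_convexOn (by linarith)
    exact ⟨ε, hε, neg_convexOn_iff.1 hc⟩
  · rintro ⟨hne, hc⟩
    obtain ⟨z, hz⟩ := exists_mem_openSegment (F.p u) (F.p v)
    obtain ⟨ε, hε, hc⟩ := hc z hz
    have := (hk.2.2 u v h z hz).neg.nonneg_of_convexOn (sub_ne_zero_of_adj h)
      (cr_of_mem_openSegment hz) hε (neg_convexOn_iff.2 hc)
    exact lt_of_le_of_ne (by linarith) hne

end PeriodicFramework

/-! ### Equilibrium stresses and the sum of shadows -/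

namespace PeriodicFramework

variable {V : Type*} {G : SimpleGraph V}

open Classical in
/-- The incidence number of a vertex and an edge in the chosen orientation. -/
noncomputable def inc (a : V) (e : G.edgeSet) : ℝ :=
  (if tl e = a then 1 else 0) - (if hd e = a then 1 else 0)

lemma mem_of_inc_ne_zero {a : V} {e : G.edgeSet} (h : inc a e ≠ 0) : a ∈ (e : Sym2 V) := by
  rw [eq_tl_or_hd]
  by_contra! hc
  exact h (by simp [inc, hc.1.symm, hc.2.symm])

-- Summation by parts: it turns a sum over edges of differences at endpoints into a sum over
-- vertices.
open Classical in
lemma sum_mul_inc (φ : V → ℝ) {A : Finset V} {e : G.edgeSet} (h1 : tl e ∈ A) (h2 : hd e ∈ A) :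
    ∑ a ∈ A, φ a * inc a e = φ (tl e) - φ (hd e) := by
  simp [inc, mul_sub, Finset.sum_sub_distrib, h1, h2]

variable (F : PeriodicFramework G)

/-- The vector of an edge in the chosen orientation. -/
noncomputable def vec (e : G.edgeSet) : Plane := F.p (hd e) - F.p (tl e)

/-- The stresses at each vertex add up to zero. -/
def IsEquilibrium (s : G.edgeSet → ℝ) : Prop :=
  ∀ a : V, ∑ᶠ e : G.edgeSet, (s e * inc a e) • F.vec e = 0

/-- `o` lies on no line spanned by an edge. -/
def IsGeneric (o : Plane) : Prop :=
  ∀ e : G.edgeSet, cr (F.p (tl e) - o) (F.p (hd e) - o) ≠ 0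

lemma vec_ne_zero (e : G.edgeSet) : F.vec e ≠ 0 := sub_ne_zero_of_adj (adj_tl_hd e)

lemma dense_isGeneric : Dense {o | F.IsGeneric o} := by
  have := F.countable_edgeSet
  convert dense_off_lines (fun e : G.edgeSet => F.p (tl e)) F.vec F.vec_ne_zero using 2
  ext o
  refine forall_congr' fun e => not_congr ?_
  rw [show cr (F.p (tl e) - o) (F.p (hd e) - o) = cr (F.vec e) (o - F.p (tl e)) by
    simp only [vec, cr, PiLp.sub_apply]; ring]

/-- The height of the shadow of an edge. -/
noncomputable def edgeShadow (o : Plane) (e : G.edgeSet) (q : Plane) : ℝ :=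
  -- The coefficient is nonzero only in the double cone bounded by the lines from `o` through the
  -- endpoints; the fold vanishes there except behind the edge.
  (side o (F.p (tl e)) q - side o (F.p (hd e)) q) * fold o (F.p (tl e)) (F.p (hd e)) q

/-- The height function obtained by adding up all shadows, weighted by `s`. -/
noncomputable def shadow (s : G.edgeSet → ℝ) (o q : Plane) : ℝ :=
  ∑ᶠ e : G.edgeSet, s e * F.edgeShadow o e q

lemma exists_finset_edges (o : Plane) (R : ℝ) :
    ∃ E : Finset G.edgeSet, ∀ e, (∃ x ∈ F.seg e, dist x o ≤ R) → e ∈ E := by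
  refine ⟨(F.finite_edges (R + ‖o‖)).toFinset, fun e ⟨x, hx, hxo⟩ => ?_⟩
  rw [Finite.mem_toFinset]
  refine ⟨x, hx, ?_⟩
  have := norm_add_le (x - o) o
  rw [sub_add_cancel, ← dist_eq_norm] at this
  linarith

variable {F}

lemma IsGeneric.ne {o : Plane} (ho : F.IsGeneric o) (a : V) : F.p a - o ≠ 0 := by
  obtain ⟨e, he⟩ := F.exists_edge a
  intro h
  have := ho e
  rcases eq_tl_or_hd.1 he with rfl | rfl
  · simp [h] at this
  · simp [h] at this

/-- An edge shades `q` only if it comes at least as close to `o` as `q` does, so within a disc about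
`o` finitely many edges suffice. -/
lemma shadow_eq_sum {s : G.edgeSet → ℝ} {o : Plane} (ho : F.IsGeneric o) {R : ℝ}
    {E : Finset G.edgeSet} (hE : ∀ e, (∃ x ∈ F.seg e, dist x o ≤ R) → e ∈ E) {q : Plane}
    (hq : dist q o ≤ R) : F.shadow s o q = ∑ e ∈ E, s e * F.edgeShadow o e q := by
  refine finsum_eq_sum_of_support_subset _ fun e he => hE e ?_
  obtain ⟨x, hx, hxq⟩ := exists_mem_segment_of_shadow_ne_zero (ho e)
    (right_ne_zero_of_mul (Function.mem_support.1 he))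
  exact ⟨x, hx, hxq.trans hq⟩

lemma force_eq_sum (s : G.edgeSet → ℝ) {a : V} {E : Finset G.edgeSet}
    (hE : ∀ e : G.edgeSet, a ∈ (e : Sym2 V) → e ∈ E) :
    ∑ᶠ e : G.edgeSet, (s e * inc a e) • F.vec e = ∑ e ∈ E, (s e * inc a e) • F.vec e := by
  refine finsum_eq_sum_of_support_subset _ fun e he => hE e (mem_of_inc_ne_zero fun h => ?_)
  simp [h] at he

/-- The shadows near `q₀`, with frozen coefficients and the errors grouped by vertices. -/
lemma sum_edgeShadow_eq (s : G.edgeSet → ℝ) (o q₀ q : Plane) {E : Finset G.edgeSet} {A : Finset V}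
    (hA : ∀ e ∈ E, tl e ∈ A ∧ hd e ∈ A) :
    ∑ e ∈ E, s e * F.edgeShadow o e q =
      ∑ e ∈ E, s e * ((side o (F.p (tl e)) q₀ - side o (F.p (hd e)) q₀) *
        fold o (F.p (tl e)) (F.p (hd e)) q) +
      ∑ a ∈ A, (side o (F.p a) q - side o (F.p a) q₀) *
        ∑ e ∈ E, s e * inc a e * fold o (F.p (tl e)) (F.p (hd e)) q := by
  simp only [Finset.mul_sum]
  rw [Finset.sum_comm, ← Finset.sum_add_distrib]
  refine Finset.sum_congr rfl fun e he => ?_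
  have := sum_mul_inc (fun a => side o (F.p a) q - side o (F.p a) q₀) (hA e he).1 (hA e he).2
  have h2 : ∑ a ∈ A, (side o (F.p a) q - side o (F.p a) q₀) *
      (s e * inc a e * fold o (F.p (tl e)) (F.p (hd e)) q) =
      (∑ a ∈ A, (side o (F.p a) q - side o (F.p a) q₀) * inc a e) *
        (s e * fold o (F.p (tl e)) (F.p (hd e)) q) := by
    rw [Finset.sum_mul]
    exact Finset.sum_congr rfl fun a _ => by ring
  rw [h2, this, edgeShadow]
  ring

lemma IsGeneric.fold_eventually_eq_zero {o : Plane} (ho : F.IsGeneric o) {a : V} {e : G.edgeSet}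
    (ha : a ∈ (e : Sym2 V)) {τ : ℝ} (hτ : τ < 1) :
    ∀ᶠ q in 𝓝 (o + τ • (F.p a - o)), fold o (F.p (tl e)) (F.p (hd e)) q = 0 := by
  rcases eq_tl_or_hd.1 ha with rfl | rfl
  · exact _root_.fold_eventually_eq_zero hτ (ho e)
  · have h : cr (F.p (hd e) - o) (F.p (tl e) - o) ≠ 0 := by
      rw [cr_swap]; exact neg_ne_zero.2 (ho e)
    filter_upwards [_root_.fold_eventually_eq_zero hτ h] with q hq
    rw [fold_swap h, hq, neg_zero]

lemma IsGeneric.fold_eventually_eq_cr {o : Plane} (ho : F.IsGeneric o) {a : V} {e : G.edgeSet}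
    (ha : a ∈ (e : Sym2 V)) {τ : ℝ} (hτ : 1 < τ) :
    ∀ᶠ q in 𝓝 (o + τ • (F.p a - o)),
      fold o (F.p (tl e)) (F.p (hd e)) q = -cr (F.vec e) (q - F.p a) := by
  rcases eq_tl_or_hd.1 ha with rfl | rfl
  · exact _root_.fold_eventually_eq_cr hτ (ho e)
  · have h : cr (F.p (hd e) - o) (F.p (tl e) - o) ≠ 0 := by
      rw [cr_swap]; exact neg_ne_zero.2 (ho e)
    filter_upwards [_root_.fold_eventually_eq_cr hτ h] with q hq
    rw [fold_swap h, hq, vec, ← neg_sub (F.p (tl e)) (F.p (hd e))]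
    simp only [cr, PiLp.neg_apply]; ring

/-- Behind `a`, every edge at `a` has as its fold a cross product based at `a`, so the jump across
the ray depends only on the resultant of the forces at `a`. -/
lemma IsGeneric.sum_fold_eventually_eq {o : Plane} (ho : F.IsGeneric o) (s : G.edgeSet → ℝ)
    (E : Finset G.edgeSet) (a : V) {τ : ℝ} (hτ : 1 < τ) :
    ∀ᶠ q in 𝓝 (o + τ • (F.p a - o)),
      ∑ e ∈ E, s e * inc a e * fold o (F.p (tl e)) (F.p (hd e)) q =
        -cr (∑ e ∈ E, (s e * inc a e) • F.vec e) (q - F.p a) := by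
  have : ∀ e ∈ E, ∀ᶠ q in 𝓝 (o + τ • (F.p a - o)), inc a e ≠ 0 →
      fold o (F.p (tl e)) (F.p (hd e)) q = -cr (F.vec e) (q - F.p a) := by
    intro e _
    by_cases h : inc a e = 0
    · simp [h]
    · filter_upwards [ho.fold_eventually_eq_cr (mem_of_inc_ne_zero h) hτ] with q hq _ using hq
  filter_upwards [(Finset.eventually_all E).2 this] with q hq
  rw [cr_sum, ← Finset.sum_neg_distrib]
  refine Finset.sum_congr rfl fun e he => ?_
  by_cases h : inc a e = 0
  · simp [h]
  · rw [hq e he h, smul_cr]; ring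

lemma exists_eq_add_smul {o a q : Plane} (ha : a - o ≠ 0) (h : cr (a - o) (q - o) = 0) :
    ∃ τ : ℝ, q = o + τ • (a - o) := by
  obtain ⟨τ, hτ⟩ := exists_eq_lineMap_of_cr_eq_zero ha h
  exact ⟨τ, by rw [← hτ]; abel⟩

/-- Away from the vertex, its error term vanishes if the forces beyond the vertex cancel. -/
lemma IsGeneric.error_eventually_eq_zero {o : Plane} (ho : F.IsGeneric o) (s : G.edgeSet → ℝ)
    (E : Finset G.edgeSet) {a : V} {q₀ : Plane} (hne : q₀ ≠ F.p a)
    (hE : ∀ τ : ℝ, 1 < τ → q₀ = o + τ • (F.p a - o) → ∑ e ∈ E, (s e * inc a e) • F.vec e = 0) :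
    ∀ᶠ q in 𝓝 q₀, (side o (F.p a) q - side o (F.p a) q₀) *
      ∑ e ∈ E, s e * inc a e * fold o (F.p (tl e)) (F.p (hd e)) q = 0 := by
  -- Off the line through `o` and the vertex, `side` is locally constant. On the line, the folds
  -- vanish before the vertex, and behind it they add up to the resultant.
  by_cases hcr : cr (F.p a - o) (q₀ - o) = 0
  · obtain ⟨τ, hτ⟩ := exists_eq_add_smul (ho.ne a) hcr
    rcases lt_trichotomy τ 1 with h1 | h1 | h1
    · have : ∀ e ∈ E, ∀ᶠ q in 𝓝 q₀, s e * inc a e * fold o (F.p (tl e)) (F.p (hd e)) q = 0 := by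
        intro e _
        by_cases h : inc a e = 0
        · simp [h]
        · rw [hτ]
          filter_upwards [ho.fold_eventually_eq_zero (mem_of_inc_ne_zero h) h1] with q hq
          rw [hq, mul_zero]
      filter_upwards [(Finset.eventually_all E).2 this] with q hq
      rw [Finset.sum_eq_zero hq, mul_zero]
    · exact absurd (by rw [hτ, h1, one_smul]; abel) hne
    · have h2 := ho.sum_fold_eventually_eq s E a h1
      rw [← hτ] at h2
      filter_upwards [h2] with q hq
      rw [hq, hE τ h1 hτ, zero_cr, neg_zero, mul_zero]
  · filter_upwards [side_eventuallyEq hcr] with q hq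
    rw [hq, sub_self, zero_mul]

/-- At the vertex itself the coefficient is merely bounded, but the folds of the edges ending there
are continuous and vanish there. -/
lemma tendsto_error (s : G.edgeSet → ℝ) (o : Plane) (E : Finset G.edgeSet) (a : V) :
    Tendsto (fun q => (side o (F.p a) q - side o (F.p a) (F.p a)) *
      ∑ e ∈ E, s e * inc a e * fold o (F.p (tl e)) (F.p (hd e)) q) (𝓝 (F.p a)) (𝓝 0) := by
  refine bdd_le_mul_tendsto_zero' 1 (Eventually.of_forall fun q => ?_) ?_
  · unfold side
    split_ifs <;> norm_num
  · have hc : Continuous fun q : Plane =>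
        ∑ e ∈ E, s e * inc a e * fold o (F.p (tl e)) (F.p (hd e)) q :=
      continuous_finsetSum E fun e _ => continuous_const.mul (continuous_fold _ _ _)
    have h0 : ∑ e ∈ E, s e * inc a e * fold o (F.p (tl e)) (F.p (hd e)) (F.p a) = 0 := by
      refine Finset.sum_eq_zero fun e _ => ?_
      by_cases h : inc a e = 0
      · simp [h]
      · rcases eq_tl_or_hd.1 (mem_of_inc_ne_zero h) with rfl | rfl
        · rw [fold_self, mul_zero]
        · rw [fold_right, mul_zero]
    have := hc.tendsto (F.p a)
    rwa [h0] at this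

/-- The shadows with frozen coefficients have the right kinks. -/
lemma affAt_sum_frozen {o : Plane} (ho : F.IsGeneric o) (s : G.edgeSet → ℝ)
    {E : Finset G.edgeSet} {q₀ : Plane} (hq : ∀ e ∈ E, q₀ ∉ F.seg e) :
    AffAt (fun q => ∑ e ∈ E, s e * ((side o (F.p (tl e)) q₀ - side o (F.p (hd e)) q₀) *
      fold o (F.p (tl e)) (F.p (hd e)) q)) q₀ :=
  AffAt.sum fun e he => (affAt_frozen (ho e) (hq e he)).const_mul _

lemma kinkAt_sum_frozen (hF : F.IsNonCrossing) {o : Plane} (ho : F.IsGeneric o)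
    (s : G.edgeSet → ℝ) {E : Finset G.edgeSet} {e : G.edgeSet} (he : e ∈ E) {q₀ : Plane}
    (hq : q₀ ∈ openSegment ℝ (F.p (tl e)) (F.p (hd e))) :
    KinkAt (fun q => ∑ e ∈ E, s e * ((side o (F.p (tl e)) q₀ - side o (F.p (hd e)) q₀) *
      fold o (F.p (tl e)) (F.p (hd e)) q)) (F.p (tl e)) (F.vec e) (s e) q₀ := by
  classical
  have h1 : AffAt (fun q => ∑ e' ∈ E.erase e, s e' * ((side o (F.p (tl e')) q₀ -
      side o (F.p (hd e')) q₀) * fold o (F.p (tl e')) (F.p (hd e')) q)) q₀ := by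
    refine affAt_sum_frozen ho s fun e' he' hc => (Finset.ne_of_mem_erase he') ?_
    apply Subtype.ext
    rw [hF.eq_of_mem_seg (adj_tl_hd e) hq hc, mk_tl_hd]
  refine (AffAt.add ((kinkAt_frozen (ho e) hq).const_mul (s e)) h1).congr
    (Eventually.of_forall fun x => ?_)
  beta_reduce
  rw [← Finset.add_sum_erase E _ he, vec]
  ring

/-- Stresses in equilibrium are the kinks of the sum of their shadows. -/
theorem IsEquilibrium.hasKinks_shadow (hF : F.IsNonCrossing) {s : G.edgeSet → ℝ}
    (hs : F.IsEquilibrium s) {o : Plane} (ho : F.IsGeneric o) : F.HasKinks (F.shadow s o) s := by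
  classical
  -- Near any point, the shadow sum is a frozen sum, which has the required kinks, plus one error
  -- term per vertex; each error term vanishes nearby unless the point is that vertex.
  have key : ∀ q₀ : Plane, ∃ (E : Finset G.edgeSet) (A : Finset V),
      (∀ e, q₀ ∈ F.seg e → e ∈ E) ∧
      (∀ᶠ q in 𝓝 q₀, F.shadow s o q =
        ∑ e ∈ E, s e * ((side o (F.p (tl e)) q₀ - side o (F.p (hd e)) q₀) *
          fold o (F.p (tl e)) (F.p (hd e)) q) +
        ∑ a ∈ A, (side o (F.p a) q - side o (F.p a) q₀) *
          ∑ e ∈ E, s e * inc a e * fold o (F.p (tl e)) (F.p (hd e)) q) ∧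
      ∀ a, q₀ ≠ F.p a → ∀ᶠ q in 𝓝 q₀, (side o (F.p a) q - side o (F.p a) q₀) *
          ∑ e ∈ E, s e * inc a e * fold o (F.p (tl e)) (F.p (hd e)) q = 0 := by
    intro q₀
    obtain ⟨E, hE⟩ := F.exists_finset_edges o (dist q₀ o + 1)
    refine ⟨E, E.image tl ∪ E.image hd, fun e he => hE e ⟨q₀, he, by linarith⟩, ?_, ?_⟩
    · have : ∀ᶠ q in 𝓝 q₀, dist q o < dist q₀ o + 1 :=
        (continuous_id.dist continuous_const).continuousAt.eventually_lt_const (by simp)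
      filter_upwards [this] with q hq
      rw [shadow_eq_sum ho hE hq.le]
      refine sum_edgeShadow_eq s o q₀ q fun e he => ?_
      simp only [Finset.mem_union, Finset.mem_image]
      exact ⟨Or.inl ⟨e, he, rfl⟩, Or.inr ⟨e, he, rfl⟩⟩
    · intro a hne
      refine ho.error_eventually_eq_zero s E hne fun τ hτ hq => ?_
      -- The vertex lies between `o` and `q₀`, hence is closer to `o`, so `E` contains all its edges
      -- and sees the full resultant.
      rw [← force_eq_sum s fun e he => hE e ⟨F.p a, F.p_mem_seg he, ?_⟩, hs a]
      have : dist q₀ o = τ * dist (F.p a) o := by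
        rw [hq, dist_eq_norm, dist_eq_norm, add_sub_cancel_left, norm_smul, Real.norm_eq_abs,
          abs_of_pos (by linarith)]
      have h0 : 0 ≤ dist (F.p a) o := dist_nonneg
      nlinarith
  have hv : ∀ q₀ ∉ Set.range F.p, ∃ E : Finset G.edgeSet, (∀ e, q₀ ∈ F.seg e → e ∈ E) ∧
      ∀ᶠ q in 𝓝 q₀, F.shadow s o q =
        ∑ e ∈ E, s e * ((side o (F.p (tl e)) q₀ - side o (F.p (hd e)) q₀) *
          fold o (F.p (tl e)) (F.p (hd e)) q) := by
    intro q₀ hq₀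
    obtain ⟨E, A, hE, h1, h2⟩ := key q₀
    refine ⟨E, hE, ?_⟩
    have h3 := (Finset.eventually_all A).2 fun a _ => h2 a fun h => hq₀ ⟨a, h.symm⟩
    filter_upwards [h1, h3] with q e1 e2
    rw [e1, Finset.sum_eq_zero e2, add_zero]
  refine hasKinks_of_tl_hd (continuous_iff_continuousAt.2 fun q₀ => ?_) (fun q₀ hq₀ => ?_)
    fun e q₀ hq₀ => ?_
  · obtain ⟨E, A, hE, h1, h2⟩ := key q₀
    have h3 : ∀ a ∈ A, Tendsto (fun q => (side o (F.p a) q - side o (F.p a) q₀) *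
        ∑ e ∈ E, s e * inc a e * fold o (F.p (tl e)) (F.p (hd e)) q) (𝓝 q₀) (𝓝 0) := by
      intro a _
      by_cases h : q₀ = F.p a
      · rw [h]; exact tendsto_error s o E a
      · exact tendsto_const_nhds.congr' (by filter_upwards [h2 a h] with q hq using hq.symm)
    have h4 := tendsto_finsetSum A h3
    have h5 : Continuous fun q => ∑ e ∈ E, s e * ((side o (F.p (tl e)) q₀ -
        side o (F.p (hd e)) q₀) * fold o (F.p (tl e)) (F.p (hd e)) q) :=
      continuous_finsetSum E fun e _ =>
        continuous_const.mul (continuous_const.mul (continuous_fold _ _ _))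
    have h6 := (h5.tendsto q₀).add h4
    have h7 := h1.self_of_nhds
    simp only [sub_self, zero_mul, Finset.sum_const_zero] at h7 h6
    rw [ContinuousAt, h7]
    exact h6.congr' (by filter_upwards [h1] with q hq using hq.symm)
  · have hr : q₀ ∉ Set.range F.p := fun ⟨a, ha⟩ => hq₀ (Or.inl ⟨a, ha⟩)
    obtain ⟨E, -, h1⟩ := hv q₀ hr
    refine (affAt_sum_frozen ho s (E := E) fun e _ hc => hq₀ ?_).congr h1
    rw [carrier_eq]; exact mem_iUnion.2 ⟨e, hc⟩
  · have hr : q₀ ∉ Set.range F.p := by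
      rintro ⟨a, rfl⟩
      have := hF.mem_of_p_mem_seg (openSegment_subset_segment _ _ _ hq₀)
      rcases eq_tl_or_hd.1 this with rfl | rfl
      · exact F.placement_ne _ _ (adj_tl_hd e) (left_mem_openSegment_iff.1 hq₀)
      · exact F.placement_ne _ _ (adj_tl_hd e) (right_mem_openSegment_iff.1 hq₀)
    obtain ⟨E, hE, h1⟩ := hv q₀ hr
    exact (kinkAt_sum_frozen hF ho s (hE e (openSegment_subset_segment _ _ _ hq₀)) hq₀).congr h1

end PeriodicFramework

/-! ### Kinks are in equilibrium at each vertex -/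

/-- A ball without a ray emanating from its centre is connected. -/
lemma isPreconnected_ball_diff_ray {o a : Plane} (ha : a - o ≠ 0) {ε : ℝ} (hε : 0 < ε) :
    IsPreconnected (Metric.ball a ε \ {q | ∃ τ : ℝ, 1 ≤ τ ∧ q = o + τ • (a - o)}) := by
  have hn : 0 < ‖a - o‖ := norm_pos_iff.2 ha
  -- The slit ball is star-shaped about the point of the line just before `a`, at distance `ε / 2`
  -- from it.
  set δ := ε / 2 / ‖a - o‖ with hδ
  have hδ0 : 0 < δ := by positivity
  have hinj : ∀ {τ τ' : ℝ}, o + τ • (a - o) = o + τ' • (a - o) → τ = τ' := fun h =>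
    smul_left_injective ℝ ha (add_left_cancel h)
  have hc : o + (1 - δ) • (a - o) ∈ Metric.ball a ε := by
    have : o + (1 - δ) • (a - o) - a = (-δ) • (a - o) := by module
    rw [Metric.mem_ball, dist_eq_norm, this, norm_smul, norm_neg, Real.norm_eq_abs,
      abs_of_pos hδ0, hδ, div_mul_cancel₀ _ hn.ne']
    linarith
  have hstar : StarConvex ℝ (o + (1 - δ) • (a - o))
      (Metric.ball a ε \ {q | ∃ τ : ℝ, 1 ≤ τ ∧ q = o + τ • (a - o)}) := by
    rintro q ⟨hq, hqr⟩ α β hα hβ hαβ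
    refine ⟨convex_ball a ε hc hq hα hβ hαβ, ?_⟩
    rintro ⟨τ, hτ, he⟩
    rcases hβ.lt_or_eq with h0 | h0
    · refine hqr ⟨(τ - α * (1 - δ)) / β, ?_, ?_⟩
      · rw [le_div_iff₀ h0]; nlinarith
      · have h1 : β • q = β • o + (τ - α * (1 - δ)) • (a - o) := by
          have : β • q = (α • (o + (1 - δ) • (a - o)) + β • q) - α • (o + (1 - δ) • (a - o)) := by
            abel
          rw [this, he]
          have h2 : o = α • o + β • o := by rw [← add_smul, hαβ, one_smul]
          nth_rewrite 1 [h2]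
          module
        have h3 : q = β⁻¹ • (β • q) := by rw [smul_smul, inv_mul_cancel₀ h0.ne', one_smul]
        rw [h3, h1, smul_add, smul_smul, smul_smul, inv_mul_cancel₀ h0.ne', one_smul,
          div_eq_inv_mul]
    · have h1 : α = 1 := by linarith
      rw [← h0, h1, one_smul, zero_smul, add_zero] at he
      have := hinj he
      linarith
  refine (hstar.isPathConnected ⟨hc, fun ⟨τ, hτ, he⟩ => ?_⟩).isConnected.isPreconnected
  have := hinj he
  linarith

namespace PeriodicFramework

variable {V : Type*} {G : SimpleGraph V} {F : PeriodicFramework G}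

/-- The kinks of a function are in equilibrium at each vertex. -/
theorem HasKinks.isEquilibrium (hF : F.IsNonCrossing) {H : Plane → ℝ} {s : G.edgeSet → ℝ}
    (hk : F.HasKinks H s) : F.IsEquilibrium s := by
  classical
  intro a
  by_contra hne
  set Eq := ∑ᶠ e : G.edgeSet, (s e * inc a e) • F.vec e with hEq
  -- If the resultant is nonzero, `o` can also avoid the line through the vertex in its direction;
  -- the jump behind the vertex is then visible.
  obtain ⟨o, ho, hoE⟩ : ∃ o, F.IsGeneric o ∧ cr Eq (o - F.p a) ≠ 0 := by
    have hopen : IsOpen {o : Plane | cr Eq (o - F.p a) ≠ 0} :=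
      isOpen_ne_fun (continuous_cr _ _) continuous_const
    obtain ⟨o, h1, h2⟩ := F.dense_isGeneric.inter_open_nonempty _ hopen
      ⟨F.p a + perp Eq, by
        rw [mem_ofPred_eq, add_sub_cancel_left]; exact (cr_perp_pos hne).ne'⟩
    exact ⟨o, h2, h1⟩
  have hao := ho.ne a
  obtain ⟨E₀, hE₀⟩ := F.exists_finset_edges (F.p a) 0
  set E := E₀.filter fun e : G.edgeSet => a ∈ (e : Sym2 V) with hEdef
  have hE : ∀ e : G.edgeSet, a ∈ (e : Sym2 V) → e ∈ E := fun e he =>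
    Finset.mem_filter.2 ⟨hE₀ e ⟨F.p a, F.p_mem_seg he, by simp⟩, he⟩
  set A := E.image tl ∪ E.image hd with hA
  have hAE : ∀ e ∈ E, tl e ∈ A ∧ hd e ∈ A := fun e he => by
    simp only [hA, Finset.mem_union, Finset.mem_image]
    exact ⟨Or.inl ⟨e, he, rfl⟩, Or.inr ⟨e, he, rfl⟩⟩
  have hAcr : ∀ b ∈ A, b ≠ a → cr (F.p b - o) (F.p a - o) ≠ 0 := by
    intro b hb hba
    have hb' : ∃ e ∈ E, b ∈ (e : Sym2 V) := by
      simp only [hA, Finset.mem_union, Finset.mem_image] at hb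
      rcases hb with ⟨e, he, rfl⟩ | ⟨e, he, rfl⟩
      · exact ⟨e, he, eq_tl_or_hd.2 (Or.inl rfl)⟩
      · exact ⟨e, he, eq_tl_or_hd.2 (Or.inr rfl)⟩
    obtain ⟨e, he, hbe⟩ := hb'
    have hae := (Finset.mem_filter.1 he).2
    have hg := ho e
    rcases eq_tl_or_hd.1 hbe with h1 | h1 <;> rcases eq_tl_or_hd.1 hae with h2 | h2
    · exact absurd (h1.trans h2.symm) hba
    · rw [h1, h2]; exact hg
    · rw [h1, h2, cr_swap]; exact neg_ne_zero.2 hg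
    · exact absurd (h1.trans h2.symm) hba
  -- a small ball around the vertex
  have hball : ∀ᶠ q in 𝓝 (F.p a), (∀ e, q ∈ F.seg e → e ∈ E) ∧
      ∀ b ∈ A, b ≠ a → cr (F.p b - o) (q - o) ≠ 0 := by
    have h2 : ∀ᶠ q in 𝓝 (F.p a), ∀ b ∈ A, b ≠ a → cr (F.p b - o) (q - o) ≠ 0 := by
      refine (Finset.eventually_all A).2 fun b hb => ?_
      by_cases hba : b = a
      · simp [hba]
      · filter_upwards [(continuous_cr (F.p b - o) o).continuousAt.eventually_ne
          (hAcr b hb hba)] with q hq _ using hq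
    filter_upwards [F.eventually_mem_seg (F.p a), h2] with q h1 h2
    exact ⟨fun e he => hE e (hF.mem_of_p_mem_seg (h1 e he)), h2⟩
  obtain ⟨ε, hε, hb⟩ := Metric.eventually_nhds_iff_ball.1 hball
  -- Only the shadows of the edges at `a`. In the small ball these edges carry all the kinks, and
  -- the rays behind their other endpoints are avoided.
  set L : Plane → ℝ := fun q => ∑ e ∈ E, s e * F.edgeShadow o e q with hL
  have hloc : ∀ q₀ ∈ Metric.ball (F.p a) ε \ {q | ∃ τ : ℝ, 1 ≤ τ ∧ q = o + τ • (F.p a - o)},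
      AffAt (fun q => H q - L q) q₀ := by
    rintro q₀ ⟨hq₀, hray⟩
    obtain ⟨hseg, hcr⟩ := hb q₀ hq₀
    have hqa : q₀ ≠ F.p a := fun h => hray ⟨1, le_rfl, by rw [h, one_smul]; abel⟩
    have herr : ∀ b ∈ A, ∀ᶠ q in 𝓝 q₀, (side o (F.p b) q - side o (F.p b) q₀) *
        ∑ e ∈ E, s e * inc b e * fold o (F.p (tl e)) (F.p (hd e)) q = 0 := by
      intro b hbA
      by_cases hba : b = a
      · subst hba
        exact ho.error_eventually_eq_zero s E hqa fun τ hτ h => absurd ⟨τ, hτ.le, h⟩ hray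
      · filter_upwards [side_eventuallyEq (hcr b hbA hba)] with q hq
        rw [hq, sub_self, zero_mul]
    have hLeq : ∀ᶠ q in 𝓝 q₀, L q = ∑ e ∈ E, s e * ((side o (F.p (tl e)) q₀ -
        side o (F.p (hd e)) q₀) * fold o (F.p (tl e)) (F.p (hd e)) q) := by
      filter_upwards [(Finset.eventually_all A).2 herr] with q hq
      rw [hL]
      beta_reduce
      rw [sum_edgeShadow_eq s o q₀ q hAE, Finset.sum_eq_zero hq, add_zero]
    by_cases hc : q₀ ∈ F.carrier
    · rw [carrier_eq, mem_iUnion] at hc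
      obtain ⟨e, he⟩ := hc
      have heE := hseg e he
      have hnot : ∀ b ∈ A, F.p b ≠ q₀ := by
        rintro b hbA rfl
        by_cases hba : b = a
        · exact hqa (by rw [hba])
        · exact hcr b hbA hba (cr_self _)
      have hopen := mem_openSegment_of_ne_left_right (hnot _ (hAE e heE).1)
        (hnot _ (hAE e heE).2) he
      have h1 := hk.2.2 _ _ (adj_tl_hd e) q₀ hopen
      have h2 : (⟨s(tl e, hd e), adj_tl_hd e⟩ : G.edgeSet) = e := Subtype.ext (mk_tl_hd e)
      rw [h2] at h1
      exact h1.affAt_sub ((kinkAt_sum_frozen hF ho s heE hopen).congr hLeq)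
    · refine (hk.2.1 q₀ hc).sub ((affAt_sum_frozen ho s fun e _ he => hc ?_).congr hLeq)
      rw [carrier_eq]; exact mem_iUnion.2 ⟨e, he⟩
  obtain ⟨ν, C, hν⟩ := exists_affine_of_affAt (isPreconnected_ball_diff_ray hao hε) hloc
  -- compare the two sides of the ray behind the vertex
  obtain ⟨τ, hτ1, hτ⟩ : ∃ τ : ℝ, 1 < τ ∧ o + τ • (F.p a - o) ∈ Metric.ball (F.p a) ε := by
    have ht : Tendsto (fun τ : ℝ => o + τ • (F.p a - o)) (𝓝[>] 1) (𝓝 (F.p a)) := by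
      have : Tendsto (fun τ : ℝ => o + τ • (F.p a - o)) (𝓝 1) (𝓝 (o + (1 : ℝ) • (F.p a - o))) :=
        Continuous.tendsto (by fun_prop) 1
      rw [one_smul, add_sub_cancel] at this
      exact this.mono_left nhdsWithin_le_nhds
    obtain ⟨τ, h1, h2⟩ := ((ht.eventually (Metric.ball_mem_nhds _ hε)).and
      self_mem_nhdsWithin).exists
    exact ⟨τ, h2, h1⟩
  set r := o + τ • (F.p a - o) with hr
  have hrl : cr (F.p a - o) (r - o) = 0 := by
    rw [hr, add_sub_cancel_left, cr_smul, cr_self, mul_zero]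
  set Lr : Plane → ℝ := fun q => ∑ e ∈ E, s e * ((side o (F.p (tl e)) r -
        side o (F.p (hd e)) r) * fold o (F.p (tl e)) (F.p (hd e)) q) with hLr
  -- At a point `r` of the slit only the error term of `a` survives. It is zero on the left of the
  -- ray and `cr Eq (q - F.p a)` on the right, yet both must agree at `r` with one continuous
  -- function.
  have hLeq : ∀ᶠ q in 𝓝 r, L q = Lr q + (side o (F.p a) q - 1) * -cr Eq (q - F.p a) := by
    have herr : ∀ b ∈ A.erase a, ∀ᶠ q in 𝓝 r, (side o (F.p b) q - side o (F.p b) r) *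
        ∑ e ∈ E, s e * inc b e * fold o (F.p (tl e)) (F.p (hd e)) q = 0 := by
      intro b hbA
      filter_upwards [side_eventuallyEq ((hb r hτ).2 b (Finset.mem_of_mem_erase hbA)
        (Finset.ne_of_mem_erase hbA))] with q hq
      rw [hq, sub_self, zero_mul]
    have haA : a ∈ A := by
      obtain ⟨e, he⟩ := F.exists_edge a
      rcases eq_tl_or_hd.1 he with h | h
      · rw [h]; exact (hAE e (hE e he)).1
      · rw [h]; exact (hAE e (hE e he)).2
    have h1 : side o (F.p a) r = 1 := by simp [side, hrl]
    filter_upwards [(Finset.eventually_all _).2 herr, ho.sum_fold_eventually_eq s E a hτ1]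
      with q h2 h3
    rw [hL, hLr]
    beta_reduce
    rw [sum_edgeShadow_eq s o r q hAE, ← Finset.add_sum_erase A _ haA, Finset.sum_eq_zero h2,
      add_zero, h3, h1, hEq, force_eq_sum s hE]
  have hK : ∀ᶠ q in 𝓝 r, cr (F.p a - o) (q - o) ≠ 0 →
      H q - Lr q - (inner ℝ ν q + C) = (side o (F.p a) q - 1) * -cr Eq (q - F.p a) := by
    filter_upwards [hLeq, Metric.isOpen_ball.mem_nhds hτ] with q h1 h2 h3
    have h4 := hν q ⟨h2, ?_⟩
    · linear_combination h4 + h1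
    · rintro ⟨τ', -, rfl⟩
      rw [add_sub_cancel_left, cr_smul, cr_self, mul_zero] at h3
      exact h3 rfl
  have hHc := hk.1
  have hLrc : Continuous Lr := continuous_finsetSum E fun e _ =>
    continuous_const.mul (continuous_const.mul (continuous_fold _ _ _))
  have hKc : Continuous fun q => H q - Lr q - (inner ℝ ν q + C) := by fun_prop
  have hleft : ∀ᶠ q in 𝓝 r, 0 < cr (F.p a - o) (q - o) →
      H q - Lr q - (inner ℝ ν q + C) = 0 := by
    filter_upwards [hK] with q h1 h2
    rw [h1 h2.ne', side, if_pos h2.le, sub_self, zero_mul]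
  have hright : ∀ᶠ q in 𝓝 r, 0 < cr (o - F.p a) (q - F.p a) →
      H q - Lr q - (inner ℝ ν q + C) = cr Eq (q - F.p a) := by
    filter_upwards [hK] with q h1 h2
    rw [cr_reverse] at h2
    rw [h1 (by linarith), side, if_neg (by linarith)]
    ring
  have e1 := (eventually_eq_closed_half hao hKc continuous_const hleft).self_of_nhds hrl.ge
  have e2 := (eventually_eq_closed_half (sub_ne_zero.2 (sub_ne_zero.1 hao).symm) hKc
    (continuous_cr Eq (F.p a)) hright).self_of_nhds (by rw [cr_reverse, hrl, neg_zero])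
  have e3 : cr Eq (r - F.p a) = (1 - τ) * cr Eq (o - F.p a) := by
    rw [← cr_smul, hr]; congr 1; module
  rw [e1, e3] at e2
  rcases mul_eq_zero.1 e2.symm with h | h
  · linarith
  · exact hoE h

end PeriodicFramework

/-! ### Counting lattice translates by floors -/

/-- The integers `k` counted are those from `-⌊x⌋` up to but excluding `-⌊y⌋`. -/
lemma finsum_indicator_floor_of_le {x y : ℝ} (h : y ≤ x) :
    ∑ᶠ k : ℤ, ((if 0 ≤ x + k then (1 : ℝ) else 0) - (if 0 ≤ y + k then 1 else 0)) = ⌊x⌋ - ⌊y⌋ := by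
  have hiff : ∀ (z : ℝ) (k : ℤ), 0 ≤ z + k ↔ -⌊z⌋ ≤ k := fun z k => by
    rw [neg_le, Int.le_floor, Int.cast_neg]
    constructor <;> intro _ <;> linarith
  have hf : ⌊y⌋ ≤ ⌊x⌋ := Int.floor_mono h
  have hterm : ∀ k : ℤ, ((if 0 ≤ x + k then (1 : ℝ) else 0) - (if 0 ≤ y + k then 1 else 0)) =
      if k ∈ Finset.Ico (-⌊x⌋) (-⌊y⌋) then 1 else 0 := by
    intro k
    simp only [hiff, Finset.mem_Ico]
    split_ifs <;> first | omega | norm_num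
  simp only [hterm]
  rw [finsum_eq_sum_of_support_subset (s := Finset.Ico (-⌊x⌋) (-⌊y⌋)) _ (fun k hk => by
    by_contra hc
    exact hk (if_neg hc))]
  rw [Finset.sum_ite_mem, Finset.inter_self, Finset.sum_const, Int.card_Ico, nsmul_eq_mul, mul_one]
  have : ((-⌊y⌋ - -⌊x⌋).toNat : ℤ) = ⌊x⌋ - ⌊y⌋ := by omega
  exact_mod_cast this

lemma finsum_indicator_floor (x y : ℝ) :
    ∑ᶠ k : ℤ, ((if 0 ≤ x + k then (1 : ℝ) else 0) - (if 0 ≤ y + k then 1 else 0)) = ⌊x⌋ - ⌊y⌋ := by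
  rcases le_total y x with h | h
  · exact finsum_indicator_floor_of_le h
  · have := finsum_indicator_floor_of_le h
    rw [← neg_sub, ← this, ← finsum_neg_distrib]
    exact finsum_congr fun k => by ring

lemma finite_support_indicator_floor (x y : ℝ) :
    (Function.support fun k : ℤ =>
      ((if 0 ≤ x + k then (1 : ℝ) else 0) - (if 0 ≤ y + k then 1 else 0))).Finite := by
  refine (Set.finite_Icc (-max ⌊x⌋ ⌊y⌋) (-min ⌊x⌋ ⌊y⌋)).subset fun k hk => ?_
  have hiff : ∀ (z : ℝ) (k : ℤ), 0 ≤ z + k ↔ -⌊z⌋ ≤ k := fun z k => by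
    rw [neg_le, Int.le_floor, Int.cast_neg]
    constructor <;> intro _ <;> linarith
  simp only [hiff, Function.mem_support] at hk
  rw [mem_Icc]
  split_ifs at hk <;> first | omega | simp at hk

/-- Counting, row by row, the translates that meet the unit interval. -/
lemma finsum_crossings (x x' : ℝ) (y : ℤ → ℝ)
    (hy : ∀ k : ℤ, ((if 0 ≤ x + k then (1 : ℝ) else 0) - (if 0 ≤ x' + k then 1 else 0)) ≠ 0 →
      ∀ l : ℤ, y k + l ≠ 0) :
    ∑ᶠ c : ℤ × ℤ, ((if 0 ≤ x + c.1 then (1 : ℝ) else 0) - (if 0 ≤ x' + c.1 then 1 else 0)) *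
      (if 0 < y c.1 + c.2 ∧ y c.1 + c.2 < 1 then 1 else 0) = ⌊x⌋ - ⌊x'⌋ := by
  have key : ∀ k : ℤ, (∀ l : ℤ, y k + l ≠ 0) → ∀ l : ℤ,
      (0 < y k + l ∧ y k + l < 1) ↔ l = -⌊y k⌋ := by
    intro k hk l
    constructor
    · rintro ⟨h1, h2⟩
      have : ⌊y k⌋ = -l := by
        rw [Int.floor_eq_iff]; push_cast; constructor <;> linarith
      omega
    · rintro rfl
      have h1 := Int.floor_le (y k)
      have h2 := Int.lt_floor_add_one (y k)
      have h3 := hk (-⌊y k⌋)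
      push_cast at h3 ⊢
      exact ⟨lt_of_le_of_ne (by linarith) h3.symm, by linarith⟩
  have hfin := finite_support_indicator_floor x x'
  rw [finsum_curry]
  · rw [← finsum_indicator_floor x x']
    refine finsum_congr fun k => ?_
    simp only
    by_cases h : ((if 0 ≤ x + k then (1 : ℝ) else 0) - (if 0 ≤ x' + k then 1 else 0)) = 0
    · simp only [h, zero_mul, finsum_zero]
    -- Since `y k` is not an integer, exactly one integer translate of it falls into the open unit
    -- interval.
    · rw [finsum_eq_single _ (-⌊y k⌋)]
      · rw [if_pos ((key k (hy k h) _).2 rfl), mul_one]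
      · intro l hl
        rw [if_neg fun hc => hl ((key k (hy k h) l).1 hc), mul_zero]
  · refine (hfin.image fun k => (k, -⌊y k⌋)).subset fun c hc => ?_
    have h1 := left_ne_zero_of_mul (Function.mem_support.1 hc)
    have h2 := right_ne_zero_of_mul (Function.mem_support.1 hc)
    refine ⟨c.1, h1, Prod.ext rfl ?_⟩
    by_contra hne
    exact h2 (if_neg fun hcc => hne ((key c.1 (hy c.1 h1) c.2).1 hcc).symm)

/-! ### Orbit sums and the kernel of the transposed rigidity matrix -/

namespace PeriodicFramework

variable {V : Type*} {G : SimpleGraph V} {F : PeriodicFramework G}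

lemma gamma_comm (F : PeriodicFramework G) (γ γ' : F.Γ) : γ * γ' = γ' * γ :=
  F.period_injective (by rw [period_mul, period_mul, add_comm])

lemma gamma_eq_of_apply_eq {γ γ' : F.Γ} {v : V} (h : (γ : G ≃g G) v = (γ' : G ≃g G) v) :
    γ = γ' := by
  have h1 := F.p_apply γ v
  rw [h, p_apply] at h1
  exact (F.period_injective (add_left_cancel h1)).symm

lemma gamma_eq_of_mapEdgeSet_eq {γ γ' : F.Γ} {e : G.edgeSet}
    (h : (γ : G ≃g G).mapEdgeSet e = (γ' : G ≃g G).mapEdgeSet e) : γ = γ' := by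
  have h1 := congrArg (Subtype.val) h
  rw [coe_mapEdgeSet, coe_mapEdgeSet, Sym2.eq_iff] at h1
  rcases h1 with ⟨h1, -⟩ | ⟨h1, h2⟩
  · exact gamma_eq_of_apply_eq h1
  -- The images could agree with reversed endpoints. Adding the two endpoint equations cancels the
  -- endpoints and leaves twice the difference of the periods equal to zero.
  · have e1 := congrArg F.p h1
    have e2 := congrArg F.p h2
    rw [p_apply, p_apply] at e1 e2
    apply F.period_injective
    have h3 : (2 : ℝ) • (F.period γ - F.period γ') = 0 := by
      have : (2 : ℝ) • (F.period γ - F.period γ') = (F.p (tl e) + F.period γ + (F.p (hd e) +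
        F.period γ)) - (F.p (hd e) + F.period γ' + (F.p (tl e) + F.period γ')) := by module
      rw [this, e1, e2, sub_self]
    exact sub_eq_zero.1 ((smul_eq_zero.1 h3).resolve_left two_ne_zero)

namespace Representatives

variable {n m : ℕ} (R : F.Representatives n m)

/-- The element of the periodicity group with given integer coordinates. -/
def elt (c : ℤ × ℤ) : F.Γ := R.gen 0 ^ c.1 * R.gen 1 ^ c.2

lemma period_elt (c : ℤ × ℤ) : F.period (R.elt c) =
    (c.1 : ℝ) • F.period (R.gen 0) + (c.2 : ℝ) • F.period (R.gen 1) := by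
  rw [elt, period_mul, period_zpow, period_zpow]

lemma elt_bijective : Function.Bijective R.elt := by
  constructor
  · intro c c' h
    obtain ⟨d, -, hd⟩ := R.gen_basis (R.elt c)
    have h1 := hd ![c.1, c.2] rfl
    have h2 := hd ![c'.1, c'.2] h.symm
    have h3 := h1.trans h2.symm
    exact Prod.ext (congrFun h3 0) (congrFun h3 1)
  · intro γ
    obtain ⟨c, hc, -⟩ := R.gen_basis γ
    exact ⟨(c 0, c 1), hc⟩

/-- The generators span the lattice, so if they were parallel, the lattice basis would be parallel
too. -/
lemma cr_gen_ne_zero : cr (F.period (R.gen 0)) (F.period (R.gen 1)) ≠ 0 := by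
  obtain ⟨b, hb⟩ := F.lattice
  have hmem : ∀ i, ∃ c : ℤ × ℤ, b i =
      (c.1 : ℝ) • F.period (R.gen 0) + (c.2 : ℝ) • F.period (R.gen 1) := by
    intro i
    have : b i ∈ Set.range fun γ : F.Γ => (F.π γ).toAdd := by
      rw [hb]; exact Submodule.subset_span ⟨i, rfl⟩
    obtain ⟨γ, hγ⟩ := this
    obtain ⟨c, rfl⟩ := R.elt_bijective.2 γ
    exact ⟨c, by rw [← R.period_elt]; exact hγ.symm⟩
  intro h
  obtain ⟨c, hc⟩ := hmem 0
  obtain ⟨d, hd⟩ := hmem 1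
  have h1 : cr (b 0) (b 1) = 0 := by
    rw [hc, hd]
    simp only [add_cr, cr_add, smul_cr, cr_smul, cr_self, h, cr_swap (F.period (R.gen 1))]
    ring
  obtain ⟨t, ht⟩ := exists_eq_lineMap_of_cr_eq_zero (b.ne_zero 0) h1
  have h2 := b.linearIndependent
  rw [Fintype.linearIndependent_iff] at h2
  have h3 := h2 ![-t, 1] (by simp [Fin.sum_univ_two, ht]) 1
  simp at h3

/-- The first endpoint of an edge representative. -/
def src (β : Fin m) : V := R.vtx (R.tail β)

/-- The second endpoint of an edge representative. -/
def tgt (β : Fin m) : V := (R.elt (R.c β 0, R.c β 1) : G ≃g G) (R.vtx (R.head β))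

lemma coe_edge (β : Fin m) : (R.edge β : Sym2 V) = s(R.src β, R.tgt β) := R.edge_eq β

lemma edgeVector_eq (β : Fin m) : R.edgeVector β = F.p (R.tgt β) - F.p (R.src β) := by
  rw [edgeVector, tgt, p_apply, period_elt, Fin.sum_univ_two]
  rfl

lemma coe_map_edge (γ : F.Γ) (β : Fin m) : ((γ : G ≃g G).mapEdgeSet (R.edge β) : Sym2 V) =
    s((γ : G ≃g G) (R.src β), (γ : G ≃g G) (R.tgt β)) := by
  rw [coe_mapEdgeSet]
  exact apply_tl_hd (fun u v => s((γ : G ≃g G) u, (γ : G ≃g G) v)) (fun _ _ => Sym2.eq_swap)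
    (R.coe_edge β)

/-- The group acts freely on edges, since reversing an edge by a translation is impossible; hence
sums over edges become double sums over representatives and the group. -/
lemma map_edge_bijective : Function.Bijective
    fun x : Fin m × F.Γ => ((x.2 : F.Γ) : G ≃g G).mapEdgeSet (R.edge x.1) := by
  constructor
  · rintro ⟨β, γ⟩ ⟨β', γ'⟩ h
    simp only at h
    obtain ⟨β₀, -, h0⟩ := R.edge_unique ((γ : G ≃g G).mapEdgeSet (R.edge β))
    obtain rfl : β = β' := (h0 β ⟨γ, rfl⟩).trans (h0 β' ⟨γ', h.symm⟩).symm
    rw [gamma_eq_of_mapEdgeSet_eq h]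
  · intro e
    obtain ⟨β, ⟨γ, h⟩, -⟩ := R.edge_unique e
    exact ⟨(β, γ), h⟩

/-- A sum over all edges, orbit by orbit. -/
lemma finsum_edges {M : Type*} [AddCommMonoid M] (f : G.edgeSet → M)
    (hf : (Function.support f).Finite) :
    ∑ᶠ e, f e = ∑ β, ∑ᶠ γ : F.Γ, f ((γ : G ≃g G).mapEdgeSet (R.edge β)) := by
  have h1 := finsum_comp_equiv (Equiv.ofBijective _ R.map_edge_bijective) (f := f)
  rw [← h1, finsum_curry, finsum_eq_sum_of_fintype]
  · rfl
  · exact hf.preimage (Equiv.injective _).injOn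

open Classical in
lemma finsum_apply_eq (γ₁ γ₀ : F.Γ) (i j : Fin n) :
    (Function.support fun γ : F.Γ => if (γ : G ≃g G) ((γ₁ : G ≃g G) (R.vtx j)) =
      (γ₀ : G ≃g G) (R.vtx i) then (1 : ℝ) else 0).Finite ∧
    ∑ᶠ γ : F.Γ, (if (γ : G ≃g G) ((γ₁ : G ≃g G) (R.vtx j)) = (γ₀ : G ≃g G) (R.vtx i)
      then (1 : ℝ) else 0) = if j = i then 1 else 0 := by
  have key : ∀ γ : F.Γ, (γ : G ≃g G) ((γ₁ : G ≃g G) (R.vtx j)) = (γ₀ : G ≃g G) (R.vtx i) ↔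
      j = i ∧ γ = γ₀ * γ₁⁻¹ := by
    intro γ
    have h1 : (γ : G ≃g G) ((γ₁ : G ≃g G) (R.vtx j)) = ((γ * γ₁ : F.Γ) : G ≃g G) (R.vtx j) := rfl
    rw [h1]
    constructor
    · intro h
      obtain ⟨i₀, -, h0⟩ := R.vtx_unique ((γ₀ : G ≃g G) (R.vtx i))
      obtain rfl : j = i := (h0 j ⟨_, h⟩).trans (h0 i ⟨_, rfl⟩).symm
      exact ⟨rfl, by rw [← gamma_eq_of_apply_eq h]; group⟩
    · rintro ⟨rfl, rfl⟩
      simp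
  simp only [key]
  constructor
  · refine (Set.finite_singleton (γ₀ * γ₁⁻¹)).subset fun γ hγ => ?_
    by_contra hc
    exact hγ (if_neg fun h => hc h.2)
  · rw [finsum_eq_single _ (γ₀ * γ₁⁻¹) fun γ hγ => if_neg fun h => hγ h.2]
    simp

/-- The force at a vertex orbit. -/
def force (s : G.edgeSet → ℝ) (i : Fin n) : Plane :=
  ∑ β, (s (R.edge β) * ((if R.tail β = i then 1 else 0) - (if R.head β = i then 1 else 0))) •
    R.edgeVector β

/-- Each representative contributes once for each of its ends in the orbit of `i`, because exactly
one translate has that end at the given vertex. -/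
lemma finsum_force {s : G.edgeSet → ℝ}
    (hs : ∀ (γ : F.Γ) (e : G.edgeSet), s ((γ : G ≃g G).mapEdgeSet e) = s e) (γ₀ : F.Γ)
    (i : Fin n) : ∑ᶠ e : G.edgeSet, (s e * inc ((γ₀ : G ≃g G) (R.vtx i)) e) • F.vec e =
      R.force s i := by
  classical
  rw [R.finsum_edges]
  · refine Finset.sum_congr rfl fun β _ => ?_
    have h1 : ∀ γ : F.Γ, (s ((γ : G ≃g G).mapEdgeSet (R.edge β)) *
        inc ((γ₀ : G ≃g G) (R.vtx i)) ((γ : G ≃g G).mapEdgeSet (R.edge β))) •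
          F.vec ((γ : G ≃g G).mapEdgeSet (R.edge β)) =
        (s (R.edge β) * ((if (γ : G ≃g G) (((1 : F.Γ) : G ≃g G) (R.vtx (R.tail β))) =
          (γ₀ : G ≃g G) (R.vtx i) then 1 else 0) -
          (if (γ : G ≃g G) ((R.elt (R.c β 0, R.c β 1) : G ≃g G) (R.vtx (R.head β))) =
          (γ₀ : G ≃g G) (R.vtx i) then 1 else 0))) • R.edgeVector β := by
      intro γ
      rw [hs, mul_smul, mul_smul]
      congr 1
      refine (apply_tl_hd (fun u v => ((if u = (γ₀ : G ≃g G) (R.vtx i) then (1 : ℝ) else 0) -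
        (if v = (γ₀ : G ≃g G) (R.vtx i) then 1 else 0)) • (F.p v - F.p u)) (fun u v => ?_)
        (R.coe_map_edge γ β)).trans ?_
      · module
      · simp only [edgeVector_eq, p_apply, add_sub_add_right_eq_sub]
        rfl
    simp only [h1]
    rw [← finsum_smul, ← mul_finsum, finsum_sub_distrib, (R.finsum_apply_eq 1 γ₀ i _).2,
      (R.finsum_apply_eq _ γ₀ i _).2]
    · exact (R.finsum_apply_eq 1 γ₀ i _).1
    · exact (R.finsum_apply_eq _ γ₀ i _).1
  · obtain ⟨E, hE⟩ := F.exists_finset_edges (F.p ((γ₀ : G ≃g G) (R.vtx i))) 0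
    refine E.finite_toSet.subset fun e he => hE e ⟨_, F.p_mem_seg (mem_of_inc_ne_zero (a :=
      (γ₀ : G ≃g G) (R.vtx i)) fun h => he ?_), by simp⟩
    simp [h]

lemma isEquilibrium_iff {s : G.edgeSet → ℝ}
    (hs : ∀ (γ : F.Γ) (e : G.edgeSet), s ((γ : G ≃g G).mapEdgeSet e) = s e) :
    F.IsEquilibrium s ↔ ∀ i, R.force s i = 0 := by
  constructor
  · intro h i
    rw [← R.finsum_force hs 1 i]
    exact h _
  · intro h a
    obtain ⟨i, ⟨γ, rfl⟩, -⟩ := R.vtx_unique a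
    rw [R.finsum_force hs, h]

/-- The force on a period generator. -/
def latticeForce (s : G.edgeSet → ℝ) (k : Fin 2) : Plane :=
  ∑ β, (s (R.edge β) * R.c β k) • R.edgeVector β

lemma isPeriodicStress_iff (s : G.edgeSet → ℝ) : R.IsPeriodicStress s ↔
    (∀ (γ : F.Γ) (e : G.edgeSet), s ((γ : G ≃g G).mapEdgeSet e) = s e) ∧
      (∀ i, R.force s i = 0) ∧ ∀ k, R.latticeForce s k = 0 := by
  have happ : ∀ {x : Plane}, x = 0 ↔ ∀ l, x l = 0 :=
    ⟨fun h l => by simp [h], fun h => by ext l; exact h l⟩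
  refine and_congr_right fun _ => ?_
  rw [funext_iff, Sum.forall, Prod.forall, Prod.forall]
  refine and_congr (forall_congr' fun i => ?_) (forall_congr' fun k => ?_)
  · rw [happ]
    refine forall_congr' fun l => ?_
    -- The matrix has head minus tail, the force tail minus head.
    rw [← neg_eq_zero]
    apply iff_of_eq
    congr 1
    simp only [Matrix.mulVec, dotProduct, rigidityMatrix, force, Matrix.transpose_apply,
      Matrix.of_apply, Sum.elim_inl, WithLp.ofLp_sum, Finset.sum_apply,
      WithLp.ofLp_smul, Pi.smul_apply, smul_eq_mul, ← Finset.sum_neg_distrib]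
    refine Finset.sum_congr rfl fun β _ => ?_
    split_ifs <;> ring
  · rw [happ]
    refine forall_congr' fun l => ?_
    apply iff_of_eq
    congr 1
    simp only [Matrix.mulVec, dotProduct, rigidityMatrix, latticeForce, Matrix.transpose_apply,
      Matrix.of_apply, Sum.elim_inr, WithLp.ofLp_sum, Finset.sum_apply,
      WithLp.ofLp_smul, Pi.smul_apply, smul_eq_mul]
    exact Finset.sum_congr rfl fun β _ => by ring

/-- The same representatives, with the two generators interchanged. -/
def swap : F.Representatives n m where
  gen := ![R.gen 1, R.gen 0]
  gen_basis γ := by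
    obtain ⟨c, hc, hu⟩ := R.gen_basis γ
    refine ⟨![c 1, c 0], by simpa [F.gamma_comm (R.gen 1 ^ c 1)] using hc, fun d hd => ?_⟩
    have := hu ![d 1, d 0] (by simpa [F.gamma_comm (R.gen 0 ^ d 1)] using hd)
    ext i
    fin_cases i
    · simp [← this]
    · simp [← this]
  vtx := R.vtx
  vtx_unique := R.vtx_unique
  edge := R.edge
  edge_unique := R.edge_unique
  tail := R.tail
  head := R.head
  c β := ![R.c β 1, R.c β 0]
  edge_eq β := by
    rw [R.edge_eq β, F.gamma_comm (R.gen 0 ^ R.c β 0)]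
    rfl

lemma swap_edgeVector (β : Fin m) : R.swap.edgeVector β = R.edgeVector β := by
  simp [edgeVector, swap, Fin.sum_univ_two, add_comm]

lemma swap_latticeForce (s : G.edgeSet → ℝ) :
    R.swap.latticeForce s 0 = R.latticeForce s 1 := by
  simp only [latticeForce, swap_edgeVector]
  rfl

lemma swap_force (s : G.edgeSet → ℝ) (i : Fin n) : R.swap.force s i = R.force s i := by
  simp only [force, swap_edgeVector]
  rfl

end Representatives

end PeriodicFramework

/-! ### The gradient of the shadow sum one period away -/

/-- The indicator of the event that the segment from `a` to `b` crosses the segment from `o` to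
`o + w` in case it crosses the line through these two points. -/
noncomputable def crosses (o w a b : Plane) : ℝ :=
  -- The quotient is the parameter `t` at which `o + t • w` meets the line through `a` and `b`. In
  -- the parallel case it defaults to zero, so no crossing is recorded.
  if 0 < cr (a - o) (b - o) / cr w (b - a) ∧ cr (a - o) (b - o) / cr w (b - a) < 1 then 1 else 0

lemma crosses_symm (o w a b : Plane) : crosses o w a b = crosses o w b a := by
  have : cr (a - o) (b - o) / cr w (b - a) = cr (b - o) (a - o) / cr w (a - b) := by
    rw [cr_swap (b - o), ← neg_sub b a, show cr w (-(b - a)) = -cr w (b - a) by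
      simp only [cr, PiLp.neg_apply]; ring, neg_div_neg_eq]
  rw [crosses, crosses, this]

lemma one_lt_div_iff_inv {D c : ℝ} : 1 < c / D ↔ 0 < D / c ∧ D / c < 1 := by
  rw [← inv_div D c]
  constructor
  · intro h
    have h0 : 0 < D / c := inv_pos.1 (by linarith)
    exact ⟨h0, (one_lt_inv₀ h0).1 h⟩
  · rintro ⟨h0, h1⟩
    exact (one_lt_inv₀ h0).2 h1

/-- The height behind a line not passing through `o + w`, near this point. -/
lemma fold_eventuallyEq_crosses {o w a b : Plane} (hD : cr (a - o) (b - o) ≠ 0)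
    (h : cr (b - a) (o + w - a) ≠ 0) :
    ∀ᶠ q in 𝓝 (o + w), fold o a b q = crosses o w a b * -cr (b - a) (q - a) := by
  have hc := (continuous_cr (b - a) a).continuousAt (x := o + w)
  have hval : cr (b - a) (o + w - a) = cr (a - o) (b - o) - cr w (b - a) := by
    simp only [cr, PiLp.sub_apply, PiLp.add_apply]; ring
  unfold crosses
  simp only [← one_lt_div_iff_inv]
  rcases lt_or_gt_of_ne h with h | h <;> rcases lt_or_gt_of_ne hD with hD | hD
  · rw [if_neg (by rw [lt_div_iff_of_neg hD]; linarith)]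
    filter_upwards [hc.eventually_lt_const h] with q hq
    simp [fold, not_lt.2 hD.le, hq.le]
  · rw [if_pos (by rw [lt_div_iff₀ hD]; linarith)]
    filter_upwards [hc.eventually_lt_const h] with q hq
    simp [fold, hD, hq.le]
  · rw [if_pos (by rw [lt_div_iff_of_neg hD]; linarith)]
    filter_upwards [hc.eventually_const_lt h] with q hq
    simp [fold, not_lt.2 hD.le, hq.le]
  · rw [if_neg (by rw [lt_div_iff₀ hD]; linarith)]
    filter_upwards [hc.eventually_const_lt h] with q hq
    simp [fold, hD, hq.le]

namespace PeriodicFramework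

variable {V : Type*} {G : SimpleGraph V} {F : PeriodicFramework G}

lemma IsGeneric.add_period {o : Plane} (ho : F.IsGeneric o) (γ : F.Γ) :
    F.IsGeneric (o + F.period γ) := by
  intro e hc
  have h1 := ho (((γ⁻¹ : F.Γ) : G ≃g G).mapEdgeSet e)
  have h2 := coe_mapEdgeSet ((γ⁻¹ : F.Γ) : G ≃g G) e
  have e1 : ∀ v, F.p (((γ⁻¹ : F.Γ) : G ≃g G) v) - o = F.p v - (o + F.period γ) := fun v => by
    rw [p_apply, period_inv]; abel
  rcases tl_hd_cases h2 with ⟨h3, h4⟩ | ⟨h3, h4⟩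
  · rw [h3, h4, e1, e1, hc] at h1
    exact h1 rfl
  · rw [h3, h4, e1, e1, cr_swap, hc] at h1
    simp at h1

/-- The contribution of an edge to the change of the gradient between `o` and `o + w`. -/
noncomputable def jumpTerm (F : PeriodicFramework G) (s : G.edgeSet → ℝ) (o w : Plane)
    (e : G.edgeSet) : Plane :=
  (s e * ((side o (F.p (tl e)) (o + w) - side o (F.p (hd e)) (o + w)) *
    crosses o w (F.p (tl e)) (F.p (hd e)))) • F.vec e

/-- The base point lies strictly on the near side of every edge line, and only finitely many edges
matter nearby. -/
lemma shadow_eventually_eq_zero (s : G.edgeSet → ℝ) {o : Plane} (ho : F.IsGeneric o) :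
    ∀ᶠ q in 𝓝 o, F.shadow s o q = 0 := by
  obtain ⟨E, hE⟩ := F.exists_finset_edges o 1
  have h : ∀ e ∈ E, ∀ᶠ q in 𝓝 o, s e * F.edgeShadow o e q = 0 := fun e _ => by
    have := fold_eventually_eq_zero (τ := 0) one_pos (ho e)
    rw [zero_smul, add_zero] at this
    filter_upwards [this] with q hq
    rw [edgeShadow, hq, mul_zero, mul_zero]
  filter_upwards [(Finset.eventually_all E).2 h, Metric.closedBall_mem_nhds o one_pos] with q h1 h2
  rw [shadow_eq_sum ho hE h2, Finset.sum_eq_zero h1]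

/-- The gradient of the shadow height near a generic point. -/
lemma shadow_eventually_eq_jump (s : G.edgeSet → ℝ) {o w : Plane} (ho : F.IsGeneric o)
    (how : F.IsGeneric (o + w)) (hw : ∀ v, cr (F.p v - o) w ≠ 0) :
    (Function.support (F.jumpTerm s o w)).Finite ∧ ∃ C : ℝ, ∀ᶠ q in 𝓝 (o + w),
      F.shadow s o q = inner ℝ (-perp (∑ᶠ e, F.jumpTerm s o w e)) q + C := by
  obtain ⟨E, hE⟩ := F.exists_finset_edges o (dist (o + w) o + 1)
  have hline : ∀ e : G.edgeSet, cr (F.p (hd e) - F.p (tl e)) (o + w - F.p (tl e)) ≠ 0 := by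
    intro e hc
    refine how e ?_
    rw [← hc]
    simp only [cr, PiLp.sub_apply, PiLp.add_apply]; ring
  have hfold := fun e : G.edgeSet => fold_eventuallyEq_crosses (ho e) (hline e)
  have hsub : Function.support (F.jumpTerm s o w) ⊆ E := by
    intro e he
    have h1 : (side o (F.p (tl e)) (o + w) - side o (F.p (hd e)) (o + w)) *
        fold o (F.p (tl e)) (F.p (hd e)) (o + w) ≠ 0 := by
      rw [(hfold e).self_of_nhds, ← mul_assoc]
      refine mul_ne_zero (fun h0 => he ?_) (neg_ne_zero.2 (hline e))
      rw [jumpTerm, h0, mul_zero, zero_smul]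
    obtain ⟨x, hx, hxo⟩ := exists_mem_segment_of_shadow_ne_zero (ho e) h1
    exact hE e ⟨x, hx, by linarith⟩
  refine ⟨E.finite_toSet.subset hsub, ∑ e ∈ E, cr (F.jumpTerm s o w e) (F.p (tl e)), ?_⟩
  have hside : ∀ v, ∀ᶠ q in 𝓝 (o + w), side o (F.p v) q = side o (F.p v) (o + w) := fun v =>
    side_eventuallyEq (by rw [add_sub_cancel_left]; exact hw v)
  have hterm : ∀ e ∈ E, ∀ᶠ q in 𝓝 (o + w),
      s e * F.edgeShadow o e q = -cr (F.jumpTerm s o w e) (q - F.p (tl e)) := by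
    intro e _
    filter_upwards [hfold e, hside (tl e), hside (hd e)] with q h1 h2 h3
    rw [edgeShadow, h1, h2, h3, jumpTerm, smul_cr, vec]
    ring
  have hdist : ∀ᶠ q in 𝓝 (o + w), dist q o < dist (o + w) o + 1 :=
    (continuous_id.dist continuous_const).continuousAt.eventually_lt_const (by simp)
  filter_upwards [(Finset.eventually_all E).2 hterm, hdist] with q h1 h2
  rw [shadow_eq_sum ho hE h2.le, Finset.sum_congr rfl h1, inner_neg_left, inner_perp,
    finsum_eq_sum_of_support_subset _ hsub, cr_sum, ← Finset.sum_neg_distrib,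
    ← Finset.sum_add_distrib]
  exact Finset.sum_congr rfl fun e _ => by rw [cr_sub]; ring

namespace Representatives

variable {n m : ℕ} (R : F.Representatives n m)

/-- The coordinate of a vertex along the first period generator. -/
noncomputable def coord (o : Plane) (v : V) : ℝ :=
  cr (F.p v - o) (F.period (R.gen 1)) / cr (F.period (R.gen 0)) (F.period (R.gen 1))

lemma coord_elt (o : Plane) (v : V) (c : ℤ × ℤ) :
    R.coord o ((R.elt c : G ≃g G) v) = R.coord o v + c.1 := by
  have hΔ := R.cr_gen_ne_zero
  rw [coord, coord, p_apply, period_elt]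
  have : F.p v + ((c.1 : ℝ) • F.period (R.gen 0) + (c.2 : ℝ) • F.period (R.gen 1)) - o =
    (F.p v - o) + ((c.1 : ℝ) • F.period (R.gen 0) + (c.2 : ℝ) • F.period (R.gen 1)) := by abel
  rw [this, add_cr, add_cr, smul_cr, smul_cr, cr_self]
  field_simp
  ring

/-- The sign is the orientation of the two generators; it relates `side` to the sign of the
coordinate along the first generator. -/
lemma exists_sign : ∃ σ : ℝ, σ ≠ 0 ∧ ∀ (o : Plane) (u v : V),
    cr (F.p u - o) (F.period (R.gen 1)) ≠ 0 → cr (F.p v - o) (F.period (R.gen 1)) ≠ 0 →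
    side o (F.p u) (o + F.period (R.gen 1)) - side o (F.p v) (o + F.period (R.gen 1)) =
      σ * ((if 0 ≤ R.coord o u then 1 else 0) - (if 0 ≤ R.coord o v then 1 else 0)) := by
  rcases lt_or_gt_of_ne R.cr_gen_ne_zero with hΔ | hΔ
  · refine ⟨-1, by norm_num, fun o u v hu hv => ?_⟩
    have key : ∀ v : V, cr (F.p v - o) (F.period (R.gen 1)) ≠ 0 →
        side o (F.p v) (o + F.period (R.gen 1)) = 1 - if 0 ≤ R.coord o v then 1 else 0 := by
      intro v hv
      rw [side, coord, add_sub_cancel_left]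
      rcases lt_or_gt_of_ne hv with hv | hv
      · rw [if_neg (by linarith), if_pos (div_nonneg_of_nonpos hv.le hΔ.le)]; norm_num
      · rw [if_pos hv.le, if_neg (not_le.2 (div_neg_of_pos_of_neg hv hΔ))]; norm_num
    rw [key u hu, key v hv]; ring
  · refine ⟨1, by norm_num, fun o u v hu hv => ?_⟩
    have key : ∀ v : V, side o (F.p v) (o + F.period (R.gen 1)) =
        if 0 ≤ R.coord o v then 1 else 0 := by
      intro v
      rw [side, coord, add_sub_cancel_left]
      exact if_congr (by rw [le_div_iff₀ hΔ, zero_mul]) rfl rfl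
    rw [key u, key v]; ring

/-- The change of the gradient along the second period generator is determined by the force on the
first one. -/
lemma finsum_jumpTerm {s : G.edgeSet → ℝ}
    (hs : ∀ (γ : F.Γ) (e : G.edgeSet), s ((γ : G ≃g G).mapEdgeSet e) = s e)
    (hforce : ∀ i, R.force s i = 0) :
    ∃ σ : ℝ, σ ≠ 0 ∧ ∀ o : Plane, F.IsGeneric o →
      (∀ v, cr (F.p v - o) (F.period (R.gen 1)) ≠ 0) →
      (Function.support (F.jumpTerm s o (F.period (R.gen 1)))).Finite →
      ∑ᶠ e, F.jumpTerm s o (F.period (R.gen 1)) e = σ • R.latticeForce s 0 := by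
  classical
  obtain ⟨σ, hσ, hside⟩ := R.exists_sign
  refine ⟨-σ, neg_ne_zero.2 hσ, fun o ho hw hfin => ?_⟩
  set w := F.period (R.gen 1) with hwdef
  -- The difference of floors is the signed number of translates of `β` crossing the segment from
  -- `o` to `o + w`. Translating by the first generator shifts the coordinates by integers;
  -- translating by the second shifts the crossing parameter along the line.
  have hrow : ∀ β : Fin m, ∑ᶠ γ : F.Γ, F.jumpTerm s o w ((γ : G ≃g G).mapEdgeSet (R.edge β)) =
      (s (R.edge β) * (σ * (⌊R.coord o (R.src β)⌋ - ⌊R.coord o (R.tgt β)⌋ : ℝ))) •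
        R.edgeVector β := by
    intro β
    rw [← finsum_comp_equiv (Equiv.ofBijective _ R.elt_bijective)]
    set a : ℤ × ℤ → Plane := fun c => F.p ((R.elt c : G ≃g G) (R.src β)) with ha
    set b : ℤ × ℤ → Plane := fun c => F.p ((R.elt c : G ≃g G) (R.tgt β)) with hb
    have hab : ∀ c, b c - a c = R.edgeVector β := fun c => by
      rw [ha, hb, edgeVector_eq]
      simp only [p_apply, add_sub_add_right_eq_sub]
    have hD : ∀ c, cr (a c - o) (b c - o) ≠ 0 := by
      intro c
      have h1 := ho ((R.elt c : G ≃g G).mapEdgeSet (R.edge β))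
      rcases tl_hd_cases (R.coe_map_edge (R.elt c) β) with ⟨h3, h4⟩ | ⟨h3, h4⟩
      · rwa [h3, h4] at h1
      · rw [h3, h4, cr_swap] at h1
        exact neg_ne_zero.1 h1
    have hshift : ∀ (k l : ℤ), cr (a (k, l) - o) (b (k, l) - o) =
        cr (a (k, 0) - o) (b (k, 0) - o) + l * cr w (R.edgeVector β) := by
      intro k l
      have e1 : a (k, l) = a (k, 0) + (l : ℝ) • w := by
        simp only [ha, p_apply, period_elt, Int.cast_zero, zero_smul, add_zero, add_assoc, hwdef]
      have e2 : b (k, l) = b (k, 0) + (l : ℝ) • w := by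
        simp only [hb, p_apply, period_elt, Int.cast_zero, zero_smul, add_zero, add_assoc, hwdef]
      rw [e1, e2, ← hab (k, 0)]
      simp only [cr, PiLp.sub_apply, PiLp.add_apply, PiLp.smul_apply, smul_eq_mul]; ring
    set y : ℤ → ℝ := fun k => cr (a (k, 0) - o) (b (k, 0) - o) / cr w (R.edgeVector β) with hy
    -- an edge whose ends lie on different sides of the line is not parallel to it
    have hpar : ∀ k : ℤ, ((if 0 ≤ R.coord o (R.src β) + k then (1 : ℝ) else 0) -
        (if 0 ≤ R.coord o (R.tgt β) + k then 1 else 0)) ≠ 0 → cr w (R.edgeVector β) ≠ 0 := by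
      intro k hk h0
      apply hk
      have : R.coord o (R.src β) = R.coord o (R.tgt β) := by
        rw [coord, coord]
        congr 1
        rw [edgeVector_eq, cr_sub, cr_swap w, cr_swap w] at h0
        rw [sub_cr, sub_cr]
        linarith
      rw [this, sub_self]
    have hterm : ∀ c : ℤ × ℤ, F.jumpTerm s o w ((R.elt c : G ≃g G).mapEdgeSet (R.edge β)) =
        (s (R.edge β) * (σ * (((if 0 ≤ R.coord o (R.src β) + c.1 then (1 : ℝ) else 0) -
          (if 0 ≤ R.coord o (R.tgt β) + c.1 then 1 else 0)) *
          (if 0 < y c.1 + c.2 ∧ y c.1 + c.2 < 1 then 1 else 0)))) • R.edgeVector β := by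
      rintro ⟨k, l⟩
      have h1 : F.jumpTerm s o w ((R.elt (k, l) : G ≃g G).mapEdgeSet (R.edge β)) =
          s (R.edge β) • (((side o (a (k, l)) (o + w) - side o (b (k, l)) (o + w)) *
            crosses o w (a (k, l)) (b (k, l))) • (b (k, l) - a (k, l))) := by
        rw [jumpTerm, hs, mul_smul]
        congr 1
        refine apply_tl_hd (fun u v => ((side o (F.p u) (o + w) - side o (F.p v) (o + w)) *
          crosses o w (F.p u) (F.p v)) • (F.p v - F.p u)) (fun u v => ?_)
          (R.coe_map_edge (R.elt (k, l)) β)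
        rw [crosses_symm o w (F.p v)]
        module
      rw [h1, hab, smul_smul]
      congr 2
      rw [hside o _ _ (hw _) (hw _), coord_elt, coord_elt, mul_assoc]
      congr 1
      simp only
      by_cases h0 : ((if 0 ≤ R.coord o (R.src β) + k then (1 : ℝ) else 0) -
          (if 0 ≤ R.coord o (R.tgt β) + k then 1 else 0)) = 0
      · rw [h0, zero_mul, zero_mul]
      · congr 1
        have h2 := hpar k h0
        have h3 : cr (a (k, l) - o) (b (k, l) - o) / cr w (b (k, l) - a (k, l)) = y k + l := by
          rw [hshift, hab, hy]
          field_simp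
        rw [crosses, h3]
    have hcross := finsum_crossings (R.coord o (R.src β)) (R.coord o (R.tgt β)) y fun k hk l h0 => by
      have h2 := hpar k hk
      apply hD (k, l)
      rw [hshift]
      rw [hy] at h0
      field_simp at h0
      linarith
    have : ∀ c, F.jumpTerm s o w (((Equiv.ofBijective _ R.elt_bijective c : F.Γ) :
        G ≃g G).mapEdgeSet (R.edge β)) = _ := hterm
    rw [finsum_congr this, ← finsum_smul, ← mul_finsum, ← mul_finsum, hcross]
  rw [R.finsum_edges _ hfin, Finset.sum_congr rfl fun β _ => hrow β]
  -- The head of an edge representative is displaced by `c β 0` along the first generator, an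
  -- integer that comes out of the floor. The remaining floors depend only on the vertex orbits, so
  -- they multiply the vanishing vertex forces.
  have hfl : ∀ β : Fin m, (⌊R.coord o (R.src β)⌋ - ⌊R.coord o (R.tgt β)⌋ : ℝ) =
      ∑ i, (⌊R.coord o (R.vtx i)⌋ : ℝ) *
        ((if R.tail β = i then 1 else 0) - (if R.head β = i then 1 else 0)) - R.c β 0 := by
    intro β
    rw [tgt, coord_elt, Int.floor_add_intCast]
    simp [mul_sub, Finset.sum_sub_distrib, src, sub_sub]
  have hzero : ∑ i, (⌊R.coord o (R.vtx i)⌋ : ℝ) • R.force s i = 0 :=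
    Finset.sum_eq_zero fun i _ => by rw [hforce i, smul_zero]
  have hz2 : ∑ β, (s (R.edge β) * ∑ i, (⌊R.coord o (R.vtx i)⌋ : ℝ) *
      ((if R.tail β = i then 1 else 0) - (if R.head β = i then 1 else 0))) • R.edgeVector β = 0 := by
    rw [← hzero]
    simp only [force, Finset.smul_sum, Finset.mul_sum, Finset.sum_smul]
    rw [Finset.sum_comm]
    refine Finset.sum_congr rfl fun i _ => Finset.sum_congr rfl fun β _ => ?_
    rw [smul_smul]; congr 1; ring
  have hsplit : ∀ β : Fin m, (s (R.edge β) * (σ * (⌊R.coord o (R.src β)⌋ -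
      ⌊R.coord o (R.tgt β)⌋ : ℝ))) • R.edgeVector β =
      σ • ((s (R.edge β) * ∑ i, (⌊R.coord o (R.vtx i)⌋ : ℝ) *
      ((if R.tail β = i then 1 else 0) - (if R.head β = i then 1 else 0))) • R.edgeVector β) +
      (-σ) • ((s (R.edge β) * R.c β 0) • R.edgeVector β) := by
    intro β
    rw [hfl β]
    module
  rw [Finset.sum_congr rfl fun β _ => hsplit β, Finset.sum_add_distrib, ← Finset.smul_sum, hz2,
    smul_zero, zero_add, ← Finset.smul_sum, latticeForce]

end Representatives

end PeriodicFramework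

/-! ### Periodic functions and periodic stresses -/

namespace PeriodicFramework

variable {V : Type*} {G : SimpleGraph V} {F : PeriodicFramework G}

lemma add_period_mem_carrier (γ : F.Γ) {q : Plane} (hq : q + F.period γ ∈ F.carrier) :
    q ∈ F.carrier := by
  rw [carrier_eq, mem_iUnion] at hq ⊢
  obtain ⟨e, he⟩ := hq
  obtain ⟨e', rfl⟩ := ((γ : G ≃g G).mapEdgeSet).surjective e
  exact ⟨e', (F.mem_seg_mapEdgeSet γ e' q).1 he⟩

/-- Translating a function by a period translates its kinks. -/
lemma HasKinks.translate {H : Plane → ℝ} {s : G.edgeSet → ℝ} (hk : F.HasKinks H s) (γ : F.Γ) :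
    F.HasKinks (fun q => H (q + F.period γ)) fun e => s ((γ : G ≃g G).mapEdgeSet e) := by
  have hc := hk.1
  refine hasKinks_of_tl_hd (by fun_prop)
    (fun q hq => (hk.2.1 _ fun h => hq (add_period_mem_carrier γ h)).comp_add) fun e q hq => ?_
  have hadj : G.Adj ((γ : G ≃g G) (tl e)) ((γ : G ≃g G) (hd e)) :=
    (γ : G ≃g G).map_adj_iff.2 (adj_tl_hd e)
  have hmem : q + F.period γ ∈ openSegment ℝ (F.p ((γ : G ≃g G) (tl e)))
      (F.p ((γ : G ≃g G) (hd e))) := by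
    rw [p_apply, p_apply, add_comm q, add_comm (F.p (tl e)), add_comm (F.p (hd e)),
      mem_openSegment_translate]
    exact hq
  have h1 := hk.2.2 _ _ hadj _ hmem
  have h2 : (⟨s((γ : G ≃g G) (tl e), (γ : G ≃g G) (hd e)), hadj⟩ : G.edgeSet) =
      (γ : G ≃g G).mapEdgeSet e := Subtype.ext (coe_mapEdgeSet (γ : G ≃g G) e).symm
  rw [h2, p_apply, p_apply] at h1
  refine (AffAt.comp_add h1).congr (Eventually.of_forall fun x => ?_)
  simp only [add_sub_add_right_eq_sub]

lemma HasKinks.invariant {H : Plane → ℝ} {s : G.edgeSet → ℝ} (hk : F.HasKinks H s)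
    (hper : ∀ (γ : F.Γ) (q : Plane), H (q + F.period γ) = H q) (γ : F.Γ) (e : G.edgeSet) :
    s ((γ : G ≃g G).mapEdgeSet e) = s e := by
  have h := hk.translate γ
  simp only [hper γ] at h
  exact congrFun (h.unique hk) e

namespace Representatives

variable {n m : ℕ} (R : F.Representatives n m)

lemma period_gen_ne_zero (k : Fin 2) : F.period (R.gen k) ≠ 0 := by
  have h := R.cr_gen_ne_zero
  intro h0
  fin_cases k
  · exact h (by rw [show F.period (R.gen 0) = 0 from h0, zero_cr])
  · exact h (by rw [show F.period (R.gen 1) = 0 from h0, cr_zero])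

/-- There are base points in general position. -/
lemma exists_isGeneric : ∃ o : Plane, F.IsGeneric o ∧
    ∀ (k : Fin 2) (v : V), cr (F.p v - o) (F.period (R.gen k)) ≠ 0 := by
  have := F.countable_edgeSet
  have := F.countable_vertices
  obtain ⟨o, ho⟩ := (dense_off_lines (ι := G.edgeSet ⊕ Fin 2 × V)
    (Sum.elim (fun e => F.p (tl e)) fun x => F.p x.2)
    (Sum.elim F.vec fun x => F.period (R.gen x.1))
    (Sum.forall.2 ⟨F.vec_ne_zero, fun x => R.period_gen_ne_zero x.1⟩)).nonempty
  refine ⟨o, fun e hc => ho (Sum.inl e) ?_, fun k v hc => ho (Sum.inr (k, v)) ?_⟩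
  · rw [← hc]
    simp only [Sum.elim_inl, vec, cr, PiLp.sub_apply]; ring
  · rw [← hc]
    simp only [Sum.elim_inr, cr, PiLp.sub_apply]; ring

/-- The gradient of the shadow height behind the second period generator. -/
lemma shadow_jump {s : G.edgeSet → ℝ}
    (hs : ∀ (γ : F.Γ) (e : G.edgeSet), s ((γ : G ≃g G).mapEdgeSet e) = s e)
    (hforce : ∀ i, R.force s i = 0) :
    ∃ σ : ℝ, σ ≠ 0 ∧ ∀ o : Plane, F.IsGeneric o →
      (∀ v, cr (F.p v - o) (F.period (R.gen 1)) ≠ 0) →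
      ∃ C : ℝ, ∀ᶠ q in 𝓝 (o + F.period (R.gen 1)),
        F.shadow s o q = inner ℝ (-perp (σ • R.latticeForce s 0)) q + C := by
  obtain ⟨σ, hσ, h⟩ := R.finsum_jumpTerm hs hforce
  refine ⟨σ, hσ, fun o ho hw => ?_⟩
  obtain ⟨hfin, C, hC⟩ := shadow_eventually_eq_jump s ho (ho.add_period (R.gen 1)) hw
  exact ⟨C, by rwa [h o ho hw hfin] at hC⟩

/-- A periodic `H` has the same gradient near `o` and near `o + λ₂`. It differs from the shadow sum
by an affine function, so the shadow sum has no change of gradient there either. -/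
lemma latticeForce_zero_eq_zero (hF : F.IsNonCrossing) {H : Plane → ℝ} {s : G.edgeSet → ℝ}
    (hk : F.HasKinks H s) (hper : ∀ (γ : F.Γ) (q : Plane), H (q + F.period γ) = H q) :
    R.latticeForce s 0 = 0 := by
  have hs := hk.invariant hper
  have heq := hk.isEquilibrium hF
  obtain ⟨σ, hσ, hjump⟩ := R.shadow_jump hs ((R.isEquilibrium_iff hs).1 heq)
  obtain ⟨o, ho, hw⟩ := R.exists_isGeneric
  obtain ⟨C, hC⟩ := hjump o ho (hw 1)
  obtain ⟨ν, C', hν⟩ := hk.exists_affine_sub (heq.hasKinks_shadow hF ho)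
  have ht : Tendsto (fun q : Plane => q + F.period (R.gen 1)) (𝓝 o)
      (𝓝 (o + F.period (R.gen 1))) := (continuous_id.add continuous_const).tendsto o
  have h1 : ∀ᶠ q in 𝓝 o, inner ℝ ν q + C' = inner ℝ (ν - perp (σ • R.latticeForce s 0)) q +
      (inner ℝ (-perp (σ • R.latticeForce s 0)) (F.period (R.gen 1)) + C +
        inner ℝ ν (F.period (R.gen 1)) + C') := by
    filter_upwards [ht.eventually hC, shadow_eventually_eq_zero s ho] with q h1 h2
    have h3 := hper (R.gen 1) q
    rw [hν, hν q, h1, h2, inner_add_right, inner_add_right] at h3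
    rw [inner_sub_left]
    simp only [inner_neg_left] at h3 ⊢
    linarith
  have h2 := (affine_unique_of_eventually h1).1
  have h3 : perp (σ • R.latticeForce s 0) = 0 := by
    have : perp (σ • R.latticeForce s 0) = ν - (ν - perp (σ • R.latticeForce s 0)) := by abel
    rw [this, ← h2, sub_self]
  by_contra hne
  exact perp_ne_zero (smul_ne_zero hσ hne) h3

/-- The kinks of a periodic function form a periodic stress. -/
lemma isPeriodicStress_of_hasKinks (hF : F.IsNonCrossing) {H : Plane → ℝ} {s : G.edgeSet → ℝ}
    (hk : F.HasKinks H s) (hper : ∀ (γ : F.Γ) (q : Plane), H (q + F.period γ) = H q) :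
    R.IsPeriodicStress s := by
  have hs := hk.invariant hper
  refine (R.isPeriodicStress_iff s).2
    ⟨hs, (R.isEquilibrium_iff hs).1 (hk.isEquilibrium hF), Fin.forall_fin_two.2 ⟨?_, ?_⟩⟩
  · exact R.latticeForce_zero_eq_zero hF hk hper
  · rw [← R.swap_latticeForce]
    exact R.swap.latticeForce_zero_eq_zero hF hk hper

/-- The translated shadow sum has the same kinks, so it differs by an affine function, which is
known once it is known near `o`: there the shadow sum is zero and its translate constant. -/
lemma exists_shadow_translate_eq (hF : F.IsNonCrossing) {s : G.edgeSet → ℝ}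
    (hs : ∀ (γ : F.Γ) (e : G.edgeSet), s ((γ : G ≃g G).mapEdgeSet e) = s e)
    (hforce : ∀ i, R.force s i = 0) (hlat : R.latticeForce s 0 = 0) {o : Plane}
    (ho : F.IsGeneric o) (hw : ∀ v, cr (F.p v - o) (F.period (R.gen 1)) ≠ 0) :
    ∃ C : ℝ, ∀ q, F.shadow s o (q + F.period (R.gen 1)) = F.shadow s o q + C := by
  obtain ⟨σ, -, hjump⟩ := R.shadow_jump hs hforce
  obtain ⟨C, hC⟩ := hjump o ho hw
  have hk := ((R.isEquilibrium_iff hs).2 hforce).hasKinks_shadow hF ho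
  have hk' := hk.translate (R.gen 1)
  simp only [hs] at hk'
  obtain ⟨ν, C', hν⟩ := hk'.exists_affine_sub hk
  have ht : Tendsto (fun q : Plane => q + F.period (R.gen 1)) (𝓝 o)
      (𝓝 (o + F.period (R.gen 1))) := (continuous_id.add continuous_const).tendsto o
  have h1 : ∀ᶠ q in 𝓝 o, inner ℝ ν q + C' = inner ℝ (0 : Plane) q + C := by
    filter_upwards [ht.eventually hC, shadow_eventually_eq_zero s ho] with q h1 h2
    have h3 := hν q
    rw [h1, h2, hlat, smul_zero] at h3
    have h4 : perp 0 = 0 := by apply plane_ext <;> simp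
    rw [h4, neg_zero, inner_zero_left] at h3
    rw [inner_zero_left]
    linarith
  obtain ⟨rfl, rfl⟩ := affine_unique_of_eventually h1
  exact ⟨C', fun q => by rw [hν q, inner_zero_left, zero_add]⟩

lemma exists_inner_eq (C : Fin 2 → ℝ) : ∃ ν : Plane, ∀ k, inner ℝ ν (F.period (R.gen k)) = C k := by
  have h := R.cr_gen_ne_zero
  set a := F.period (R.gen 0) with ha
  set b := F.period (R.gen 1) with hb
  -- Up to the factor `cr a b`, the vectors `-perp b` and `perp a` form the dual basis of the two
  -- generators.
  refine ⟨(cr a b)⁻¹ • (C 1 • perp a - C 0 • perp b), Fin.forall_fin_two.2 ⟨?_, ?_⟩⟩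
  · rw [← ha, inner_smul_left, inner_sub_left, inner_smul_left, inner_smul_left, inner_perp,
      inner_perp, cr_self, cr_swap b a]
    simp only [conj_trivial]
    field_simp
    ring
  · rw [← hb, inner_smul_left, inner_sub_left, inner_smul_left, inner_smul_left, inner_perp,
      inner_perp, cr_self]
    simp only [conj_trivial]
    field_simp
    ring

lemma eq_zero_of_inner_period {ν : Plane} (h : ∀ k, inner ℝ ν (F.period (R.gen k)) = 0) :
    ν = 0 := by
  by_contra hν
  obtain ⟨σ, hσ⟩ := exists_smul_perp (R.period_gen_ne_zero 0) (h 0)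
  have h1 := h 1
  rw [hσ, inner_smul_left, inner_perp] at h1
  have h2 : σ = 0 := (mul_eq_zero.1 h1).resolve_right R.cr_gen_ne_zero
  exact hν (by rw [hσ, h2, zero_smul])

/-- A function that is invariant under both generators is periodic. -/
lemma periodic_of_gen {H : Plane → ℝ} (h : ∀ k q, H (q + F.period (R.gen k)) = H q) (γ : F.Γ)
    (q : Plane) : H (q + F.period γ) = H q := by
  let S : Subgroup F.Γ :=
    { carrier := {γ | ∀ q, H (q + F.period γ) = H q}
      one_mem' := fun q => by rw [period_one, add_zero]
      mul_mem' := fun {γ γ'} h1 h2 q => by rw [period_mul, ← add_assoc, h2, h1]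
      inv_mem' := fun {γ} h1 q => by
        have := h1 (q + F.period γ⁻¹)
        rw [← this, period_inv, neg_add_cancel_right] }
  obtain ⟨c, rfl⟩ := R.elt_bijective.2 γ
  exact S.mul_mem (S.zpow_mem (h 0) c.1) (S.zpow_mem (h 1) c.2) q

/-- A periodic stress is the system of kinks of a periodic function. -/
lemma exists_hasKinks_of_isPeriodicStress (hF : F.IsNonCrossing) {s : G.edgeSet → ℝ}
    (hR : R.IsPeriodicStress s) : ∃ H : Plane → ℝ, F.HasKinks H s ∧
      ∀ (γ : F.Γ) (q : Plane), H (q + F.period γ) = H q := by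
  obtain ⟨hs, hforce, hlat⟩ := (R.isPeriodicStress_iff s).1 hR
  obtain ⟨o, ho, hw⟩ := R.exists_isGeneric
  have hk := ((R.isEquilibrium_iff hs).2 hforce).hasKinks_shadow hF ho
  obtain ⟨C₁, h₁⟩ := R.exists_shadow_translate_eq hF hs hforce (hlat 0) ho (hw 1)
  obtain ⟨C₀, h₀⟩ : ∃ C : ℝ, ∀ q, F.shadow s o (q + F.period (R.gen 0)) = F.shadow s o q + C :=
    R.swap.exists_shadow_translate_eq hF hs (fun i => by rw [swap_force, hforce])
      (by rw [swap_latticeForce, hlat]) ho (hw 0)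
  obtain ⟨ν, hν⟩ := R.exists_inner_eq ![C₀, C₁]
  have hν0 : inner ℝ ν (F.period (R.gen 0)) = C₀ := hν 0
  have hν1 : inner ℝ ν (F.period (R.gen 1)) = C₁ := hν 1
  -- The linear function with slope `ν` grows by the same constants under the generators as the
  -- shadow sum; subtracting it does not affect the kinks.
  refine ⟨_, hk.add_affine (-ν) 0, R.periodic_of_gen
    (H := fun q => F.shadow s o q + (inner ℝ (-ν) q + 0))
    (Fin.forall_fin_two.2 ⟨fun q => ?_, fun q => ?_⟩)⟩
  · beta_reduce
    rw [h₀, inner_add_right, inner_neg_left, inner_neg_left, hν0]; ring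
  · beta_reduce
    rw [h₁, inner_add_right, inner_neg_left, inner_neg_left, hν1]; ring

end Representatives

lemma isPeriodicLifting_and_induces_iff (hF : F.IsNonCrossing) (H : Plane → ℝ)
    (s : G.edgeSet → ℝ) : (F.IsPeriodicLifting H ∧ F.Induces H s) ↔
      F.HasKinks H s ∧ ∀ (γ : F.Γ) (q : Plane), H (q + F.period γ) = H q :=
  ⟨fun h => ⟨h.1.1.hasKinks hF h.2, h.1.2⟩, fun h => ⟨⟨h.1.isLifting, h.2⟩, h.1.induces hF⟩⟩

end PeriodicFramework

/-! ### The correspondence between liftings and stresses -/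

theorem mainTheorem1 {V : Type*} {G : SimpleGraph V} (F : PeriodicFramework G)
    (hcross : F.IsNonCrossing) (hfaces : F.HasPolygonalFaces) :
    -- every periodic lifting induces exactly one system of stress factors, and it is a periodic
    -- stress (whichever representatives are used to write down the rigidity matrix)
    (∀ H : Plane → ℝ, F.IsPeriodicLifting H →
      ∃! s : G.edgeSet → ℝ, F.Induces H s) ∧
    (∀ (H : Plane → ℝ) (s : G.edgeSet → ℝ), F.IsPeriodicLifting H → F.Induces H s →
      ∀ (n m : ℕ) (R : F.Representatives n m), R.IsPeriodicStress s) ∧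
    -- every periodic stress is induced by a periodic lifting, determined up to an arbitrary
    -- additive constant
    (∀ (n m : ℕ) (R : F.Representatives n m) (s : G.edgeSet → ℝ), R.IsPeriodicStress s →
      ∃ H : Plane → ℝ, F.IsPeriodicLifting H ∧ F.Induces H s ∧
        ∀ H' : Plane → ℝ, (F.IsPeriodicLifting H' ∧ F.Induces H' s) ↔
          ∃ c : ℝ, ∀ q : Plane, H' q = H q + c) ∧
    -- the signs of the stress and the types of the lifted edges
    (∀ (H : Plane → ℝ) (s : G.edgeSet → ℝ), F.IsPeriodicLifting H → F.Induces H s →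
      ∀ (u v : V) (h : G.Adj u v),
        (s ⟨s(u, v), h⟩ < 0 ↔ F.IsMountainEdge H u v) ∧
        (0 < s ⟨s(u, v), h⟩ ↔ F.IsValleyEdge H u v) ∧
        (s ⟨s(u, v), h⟩ = 0 ↔ F.IsFlatEdge H u v)) := by

  have hiff := PeriodicFramework.isPeriodicLifting_and_induces_iff hcross
  refine ⟨fun H hH => ?_, fun H s hH hs n m R => ?_, fun n m R s hR => ?_,
    fun H s hH hs u v h => ?_⟩
  · obtain ⟨s, hs⟩ := hH.1.exists_hasKinks hcross
    exact ⟨s, hs.induces hcross, fun s' hs' => (hH.1.hasKinks hcross hs').unique hs⟩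
  · obtain ⟨hk, hper⟩ := (hiff H s).1 ⟨hH, hs⟩
    exact R.isPeriodicStress_of_hasKinks hcross hk hper
  · obtain ⟨H, hk, hper⟩ := R.exists_hasKinks_of_isPeriodicStress hcross hR
    obtain ⟨hH, hs⟩ := (hiff H s).2 ⟨hk, hper⟩
    refine ⟨H, hH, hs, fun H' => ?_⟩
    rw [hiff]
    constructor
    · rintro ⟨hk', hper'⟩
      obtain ⟨ν, C, hν⟩ := hk'.exists_affine_sub hk
      -- The affine difference of two periodic functions is itself periodic, so its gradient is
      -- orthogonal to both generators.
      have h0 : ν = 0 := R.eq_zero_of_inner_period fun k => by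
        have h1 := hper' (R.gen k) 0
        rw [hν, hν, hper, inner_add_right] at h1
        linarith
      exact ⟨C, fun q => by rw [hν q, h0, inner_zero_left, zero_add]⟩
    · rintro ⟨c, hc⟩
      obtain rfl : H' = fun q => H q + (inner ℝ (0 : Plane) q + c) :=
        funext fun q => by rw [hc, inner_zero_left, zero_add]
      exact ⟨hk.add_affine 0 c, fun γ q => by simp only [hper, inner_zero_left]⟩
  · have hk := hH.1.hasKinks hcross hs
    exact ⟨hk.neg_iff_isMountainEdge hcross h, hk.pos_iff_isValleyEdge hcross h,
      hk.eq_zero_iff_isFlatEdge hcross h⟩
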